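/- Let $n\ge 2$, let $\mathbb S^{n-1}$ be the unit sphere of $\mathbb R^n$ with surface measure $d\mathbf u$ and Laplace–Beltrami operator $\Delta_{\mathbf u}$, and let $\mathbb Y^{n+1}=\mathbb S^{n-1}\times\mathbb R\times(0,\infty)=\{(\mathbf u,b,a)\}$. Let $\mathcal S(\mathbb Y^{n+1})$ be the space of all complex-valued $\Phi\in C^\infty(\mathbb Y^{n+1})$ such that $$\rho^{l,m,k}_{s,r}(\Phi)=\sup_{(\mathbf u,b,a)\in\mathbb Y^{n+1}}\Bigl(a^s+\frac1{a^s}\Bigr)(1+b^2)^{r/2}\Bigl|\frac{\partial^l}{\partial a^l}\frac{\partial^m}{\partial b^m}\Delta_{\mathbf u}^k\Phi(\mathbf u,b,a)\Bigr|<\infty$$ for all $l,m,k,s,r\in\mathbb N_0$, with the locally convex topology defined by these seminorms. For $d\ge 1$ let $\mathcal S_0(\mathbb R^d)$ be the Lizorkin space of all $\phi\in\mathcal S(\mathbb R^d)$ with $\int_{\mathbb R^d}\mathbf x^m\phi(\mathbf x)\,d\mathbf x=0$ for all $m\in\mathbb N_0^d$, with the topology induced by the Schwartz space $\mathcal S(\mathbb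 R^d)$. Then for all $\Phi\in\mathcal S(\mathbb Y^{n+1})$, $\psi\in\mathcal S_0(\mathbb R)$ and $\mathbf x\in\mathbb R^n$ the integral $$\mathcal R^t_\psi\Phi(\mathbf x)=\int_{\mathbb S^{n-1}}\int_0^\infty\int_{-\infty}^\infty\Phi(\mathbf u,b,a)\,\frac1a\,\psi\Bigl(\frac{\mathbf x\cdot\mathbf u-b}{a}\Bigr)\frac{db\,da\,d\mathbf u}{a^n}$$ is absolutely convergent, the function $\mathcal R^t_\psi\Phi$ belongs to $\mathcal S_0(\mathbb R^n)$, and the bilinear mapping $$\mathcal S(\mathbb Y^{n+1})\times\mathcal S_0(\mathbb R)\to\mathcal S_0(\mathbb R^n),\qquad (\Phi,\psi)\mapsto\mathcal R^t_\psi\Phi,$$ is (jointly) continuous. -/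

import Mathlib

open MeasureTheory TopologicalSpace Set
open scoped Manifold ContDiff SchwartzMap InnerProductSpace

namespace Ridgelet

noncomputable section

/-- `ℝⁿ` with its Euclidean structure. -/
abbrev Euc (n : ℕ) : Type := EuclideanSpace ℝ (Fin n)

/-- The unit sphere of `ℝⁿ`. -/
abbrev Sph (n : ℕ) : Type := Metric.sphere (0 : Euc n) 1

instance instFactFinrankEuc (n : ℕ) [NeZero n] :
    Fact (Module.finrank ℝ (Euc n) = (n - 1) + 1) :=
  ⟨by rw [finrank_euclideanSpace_fin, Nat.sub_add_cancel (NeZero.one_le)]⟩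

/-- `𝕐ⁿ⁺¹ = 𝕊ⁿ⁻¹ × ℝ × ℝ₊`, the set of the triples `(u, b, a)` with `a > 0`, as an open
subset of the manifold `𝕊ⁿ⁻¹ × ℝ × ℝ`. -/
def Y (n : ℕ) : Opens (Sph n × ℝ × ℝ) :=
  ⟨{p | 0 < p.2.2}, isOpen_lt continuous_const (continuous_snd.comp continuous_snd)⟩

/-- The model with corners of the manifold `𝕊ⁿ⁻¹ × ℝ × ℝ` and of its open subset `𝕐ⁿ⁺¹`. -/
abbrev modelY (n : ℕ) := (𝓡 (n - 1)).prod (𝓘(ℝ, ℝ).prod 𝓘(ℝ, ℝ))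

/-- `Φ ∈ C^∞(𝕐ⁿ⁺¹)`. -/
def IsSmooth {n : ℕ} [NeZero n] (Φ : Y n → ℂ) : Prop :=
  ContMDiff (modelY n) 𝓘(ℝ, ℂ) ∞ Φ

/-- The extension by zero of a function on `𝕐ⁿ⁺¹` to `𝕊ⁿ⁻¹ × ℝ × ℝ`; it only serves to write
partial derivatives and integrals, and its values for `a ≤ 0` play no role. -/
def zeroExt {n : ℕ} (Φ : Y n → ℂ) (p : Sph n × ℝ × ℝ) : ℂ :=
  open Classical in if h : p ∈ Y n then Φ ⟨p, h⟩ else 0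

theorem norm_inv_smul_mem {n : ℕ} {x : Euc n} (hx : x ≠ 0) :
    ‖x‖⁻¹ • x ∈ Metric.sphere (0 : Euc n) 1 := by
  simp [norm_smul, hx]

/-- The extension `x ↦ f (x / |x|)` of a function on the sphere to `ℝⁿ ∖ {0}`, constant along
rays (with the irrelevant value `0` at the origin). -/
def radialExt {n : ℕ} (f : Sph n → ℂ) (x : Euc n) : ℂ :=
  open Classical in if hx : x ≠ 0 then f ⟨‖x‖⁻¹ • x, norm_inv_smul_mem hx⟩ else 0

/-- The Laplace-Beltrami operator of the unit sphere: the restriction to the sphere of the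
Euclidean Laplacian of the extension `x ↦ f (x / |x|)`. -/
def sphLaplacian {n : ℕ} (f : Sph n → ℂ) (u : Sph n) : ℂ :=
  Laplacian.laplacian (radialExt f) (u : Euc n)

/-- `Δ_u Φ`, the Laplace-Beltrami operator in the variable `u`. -/
def lapU {n : ℕ} (Φ : Y n → ℂ) (p : Y n) : ℂ :=
  sphLaplacian (fun u => zeroExt Φ (u, p.1.2.1, p.1.2.2)) p.1.1

/-- `∂Φ/∂b`. -/
def derivB {n : ℕ} (Φ : Y n → ℂ) (p : Y n) : ℂ :=
  deriv (fun b => zeroExt Φ (p.1.1, b, p.1.2.2)) p.1.2.1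

/-- `∂Φ/∂a`. -/
def derivA {n : ℕ} (Φ : Y n → ℂ) (p : Y n) : ℂ :=
  deriv (fun a => zeroExt Φ (p.1.1, p.1.2.1, a)) p.1.2.2

/-- `∂ˡ/∂aˡ ∂ᵐ/∂bᵐ Δ_uᵏ Φ`. -/
def mixedDeriv {n : ℕ} (l m k : ℕ) (Φ : Y n → ℂ) : Y n → ℂ :=
  derivA^[l] (derivB^[m] (lapU^[k] Φ))

/-- The weight `(aˢ + a⁻ˢ) (1 + b²)^{r/2}`. -/
def weight {n : ℕ} (s r : ℕ) (p : Y n) : ℝ :=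
  (p.1.2.2 ^ s + 1 / p.1.2.2 ^ s) * (1 + p.1.2.1 ^ 2) ^ ((r : ℝ) / 2)

/-! ### The differential operators are linear on smooth functions -/

/-- `(x, b, a) ↦ Φ (x / |x|, b, a)`. -/
def flat {n : ℕ} (Φ : Y n → ℂ) (q : Euc n × ℝ × ℝ) : ℂ :=
  radialExt (fun u => zeroExt Φ (u, q.2)) q.1

theorem zeroExt_coe {n : ℕ} (Φ : Y n → ℂ) (p : Y n) : zeroExt Φ p.1 = Φ p := by
  simp [zeroExt]

theorem radialExt_coe {n : ℕ} (f : Sph n → ℂ) (u : Sph n) : radialExt f (u : Euc n) = f u := by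
  have hu : ‖(u : Euc n)‖ = 1 := norm_eq_of_mem_sphere u
  have h0 : (u : Euc n) ≠ 0 := by
    intro h; rw [h, norm_zero] at hu; exact zero_ne_one hu
  rw [radialExt, dif_pos h0]
  congr 1
  ext1
  simp [hu]

theorem flat_coe {n : ℕ} (Φ : Y n → ℂ) (u : Sph n) (c : ℝ × ℝ) :
    flat Φ ((u : Euc n), c) = zeroExt Φ (u, c) :=
  radialExt_coe _ u

/-- The domain of `flat`. -/
def flatDom (n : ℕ) : Opens (Euc n × ℝ × ℝ) :=
  ⟨{q | q.1 ≠ 0 ∧ 0 < q.2.2},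
    (isOpen_ne_fun continuous_fst continuous_const).inter
      (isOpen_lt continuous_const (continuous_snd.comp continuous_snd))⟩

theorem mem_flatDom {n : ℕ} (p : Y n) : ((p.1.1 : Euc n), p.1.2) ∈ flatDom n := by
  refine ⟨?_, p.2⟩
  have hu : ‖(p.1.1 : Euc n)‖ = 1 := norm_eq_of_mem_sphere p.1.1
  intro h
  simp only at h
  rw [h, norm_zero] at hu
  exact zero_ne_one hu

theorem IsSmooth.contDiffOn_flat {n : ℕ} [NeZero n] {Φ : Y n → ℂ} (hΦ : IsSmooth Φ) :
    ContDiffOn ℝ ∞ (flat Φ) (flatDom n) := by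
  intro q hq
  refine ContDiffAt.contDiffWithinAt ?_
  rw [← contMDiffAt_iff_contDiffAt]
  have key := contMDiffAt_subtype_iff (I := 𝓘(ℝ, Euc n × ℝ × ℝ)) (I' := 𝓘(ℝ, ℂ)) (n := ∞)
    (U := flatDom n) (f := flat Φ) (x := ⟨q, hq⟩)
  refine key.1 ?_
  have hval : ContMDiff 𝓘(ℝ, Euc n × ℝ × ℝ) 𝓘(ℝ, Euc n × ℝ × ℝ) ∞
      (fun q : flatDom n => q.1) := contMDiff_subtype_val
  have h1 : ContMDiff 𝓘(ℝ, Euc n × ℝ × ℝ) 𝓘(ℝ, Euc n) ∞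
      (fun q : flatDom n => ‖q.1.1‖⁻¹ • q.1.1) := by
    intro x
    have : ContDiffAt ℝ ∞ (fun q : Euc n × ℝ × ℝ => ‖q.1‖⁻¹ • q.1) x.1 := by
      have hx : x.1.1 ≠ 0 := x.2.1
      exact ((contDiffAt_fst.norm ℝ hx).inv (norm_ne_zero_iff.2 hx)).smul contDiffAt_fst
    exact this.contMDiffAt.comp x (hval x)
  have h2 : ContMDiff 𝓘(ℝ, Euc n × ℝ × ℝ) (𝓡 (n - 1)) ∞
      (fun q : flatDom n => (⟨‖q.1.1‖⁻¹ • q.1.1, norm_inv_smul_mem q.2.1⟩ : Sph n)) :=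
    h1.codRestrict_sphere (fun q => norm_inv_smul_mem q.2.1)
  have h3 : ContMDiff 𝓘(ℝ, Euc n × ℝ × ℝ) 𝓘(ℝ, ℝ) ∞ (fun q : flatDom n => q.1.2.1) :=
    (contDiff_fst.comp contDiff_snd).contMDiff.comp hval
  have h4 : ContMDiff 𝓘(ℝ, Euc n × ℝ × ℝ) 𝓘(ℝ, ℝ) ∞ (fun q : flatDom n => q.1.2.2) :=
    (contDiff_snd.comp contDiff_snd).contMDiff.comp hval
  have h5 := h2.prodMk (h3.prodMk h4)
  have h6 : ContMDiffAt (modelY n) 𝓘(ℝ, ℂ) ∞ (zeroExt Φ)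
      (⟨‖q.1‖⁻¹ • q.1, norm_inv_smul_mem hq.1⟩, q.2.1, q.2.2) := by
    have := contMDiffAt_subtype_iff (I := modelY n) (I' := 𝓘(ℝ, ℂ)) (n := ∞)
      (U := Y n) (f := zeroExt Φ)
      (x := ⟨(⟨‖q.1‖⁻¹ • q.1, norm_inv_smul_mem hq.1⟩, q.2.1, q.2.2), hq.2⟩)
    refine this.1 ?_
    have e : (fun x : Y n => zeroExt Φ x.1) = Φ := funext (zeroExt_coe Φ)
    rw [e]
    exact hΦ _
  have h7 := ContMDiffAt.comp (⟨q, hq⟩ : flatDom n) h6 (h5 _)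
  refine h7.congr_of_eventuallyEq (Filter.Eventually.of_forall fun y => ?_)
  simp only [flat, radialExt, Function.comp]
  rw [dif_pos y.2.1]

theorem isSmooth_of_contDiffOn {n : ℕ} [NeZero n] {G : Euc n × ℝ × ℝ → ℂ}
    (hG : ContDiffOn ℝ ∞ G (flatDom n)) :
    IsSmooth (fun p : Y n => G ((p.1.1 : Euc n), p.1.2)) := by
  intro p
  have hG' : ContDiffAt ℝ ∞ G ((p.1.1 : Euc n), p.1.2) :=
    hG.contDiffAt ((flatDom n).isOpen.mem_nhds (mem_flatDom p))
  have hval : ContMDiff (modelY n) (modelY n) ∞ (fun p : Y n => p.1) := contMDiff_subtype_val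
  have h1 : ContMDiff (modelY n) 𝓘(ℝ, Euc n) ∞ (fun p : Y n => (p.1.1 : Euc n)) :=
    contMDiff_coe_sphere.comp (contMDiff_fst.comp hval)
  have h2 : ContMDiff (modelY n) 𝓘(ℝ, ℝ) ∞ (fun p : Y n => p.1.2.1) :=
    contMDiff_fst.comp (contMDiff_snd.comp hval)
  have h3 : ContMDiff (modelY n) 𝓘(ℝ, ℝ) ∞ (fun p : Y n => p.1.2.2) :=
    contMDiff_snd.comp (contMDiff_snd.comp hval)
  have h4 := h1.prodMk_space (h2.prodMk_space h3)
  exact ContMDiffAt.comp p hG'.contMDiffAt (h4 p)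

theorem fderiv_apply_contDiffOn {n : ℕ} {G : Euc n × ℝ × ℝ → ℂ}
    (hG : ContDiffOn ℝ ∞ G (flatDom n)) (v : Euc n × ℝ × ℝ) :
    ContDiffOn ℝ ∞ (fun q => fderiv ℝ G q v) (flatDom n) :=
  (hG.fderiv_of_isOpen (flatDom n).isOpen (m := ∞) (by simp)).clm_apply contDiffOn_const

theorem differentiableAt_of_contDiffOn {n : ℕ} {G : Euc n × ℝ × ℝ → ℂ}
    (hG : ContDiffOn ℝ ∞ G (flatDom n)) {q : Euc n × ℝ × ℝ} (hq : q ∈ flatDom n) :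
    DifferentiableAt ℝ G q :=
  (hG.contDiffAt ((flatDom n).isOpen.mem_nhds hq)).differentiableAt (by simp)

theorem derivB_eq {n : ℕ} [NeZero n] {Φ : Y n → ℂ} (hΦ : IsSmooth Φ) (p : Y n) :
    derivB Φ p = fderiv ℝ (flat Φ) ((p.1.1 : Euc n), p.1.2) (0, 1, 0) := by
  have hd := (differentiableAt_of_contDiffOn hΦ.contDiffOn_flat (mem_flatDom p)).hasFDerivAt
  have hc : HasDerivAt (fun b : ℝ => ((p.1.1 : Euc n), b, p.1.2.2)) (0, 1, 0) p.1.2.1 :=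
    (hasDerivAt_const _ _).prodMk ((hasDerivAt_id _).prodMk (hasDerivAt_const _ _))
  have h := HasFDerivAt.comp_hasDerivAt p.1.2.1 (f := fun b : ℝ => ((p.1.1 : Euc n), b, p.1.2.2))
    hd hc
  have e : (flat Φ ∘ fun b : ℝ => ((p.1.1 : Euc n), b, p.1.2.2))
      = fun b => zeroExt Φ (p.1.1, b, p.1.2.2) := funext fun b => flat_coe Φ _ _
  rw [e] at h
  exact h.deriv

theorem derivA_eq {n : ℕ} [NeZero n] {Φ : Y n → ℂ} (hΦ : IsSmooth Φ) (p : Y n) :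
    derivA Φ p = fderiv ℝ (flat Φ) ((p.1.1 : Euc n), p.1.2) (0, 0, 1) := by
  have hd := (differentiableAt_of_contDiffOn hΦ.contDiffOn_flat (mem_flatDom p)).hasFDerivAt
  have hc : HasDerivAt (fun a : ℝ => ((p.1.1 : Euc n), p.1.2.1, a)) (0, 0, 1) p.1.2.2 :=
    (hasDerivAt_const _ _).prodMk ((hasDerivAt_const _ _).prodMk (hasDerivAt_id _))
  have h := HasFDerivAt.comp_hasDerivAt p.1.2.2 (f := fun a : ℝ => ((p.1.1 : Euc n), p.1.2.1, a))
    hd hc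
  have e : (flat Φ ∘ fun a : ℝ => ((p.1.1 : Euc n), p.1.2.1, a))
      = fun a => zeroExt Φ (p.1.1, p.1.2.1, a) := funext fun b => flat_coe Φ _ _
  rw [e] at h
  exact h.deriv

theorem fderiv_slice {n : ℕ} {G : Euc n × ℝ × ℝ → ℂ}
    (hG : ContDiffOn ℝ ∞ G (flatDom n)) {q : Euc n × ℝ × ℝ} (hq : q ∈ flatDom n) (v : Euc n) :
    fderiv ℝ (fun x => G (x, q.2)) q.1 v = fderiv ℝ G q (v, 0) := by
  have hd := (differentiableAt_of_contDiffOn hG hq).hasFDerivAt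
  have hc : HasFDerivAt (fun x : Euc n => (x, q.2)) (ContinuousLinearMap.inl ℝ (Euc n) (ℝ × ℝ))
      q.1 := hasFDerivAt_prodMk_left _ _
  have h := HasFDerivAt.comp q.1 (f := fun x : Euc n => (x, q.2)) hd hc
  have h' : HasFDerivAt (fun x => G (x, q.2)) _ q.1 := h
  rw [h'.fderiv]
  simp

theorem lapU_eq {n : ℕ} [NeZero n] {Φ : Y n → ℂ} (hΦ : IsSmooth Φ) (p : Y n) :
    lapU Φ p = ∑ i : Fin (Module.finrank ℝ (Euc n)), fderiv ℝ
      (fun q => fderiv ℝ (flat Φ) q (stdOrthonormalBasis ℝ (Euc n) i, 0))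
      ((p.1.1 : Euc n), p.1.2) (stdOrthonormalBasis ℝ (Euc n) i, 0) := by
  have hF := hΦ.contDiffOn_flat
  have e : radialExt (fun u => zeroExt Φ (u, p.1.2.1, p.1.2.2))
      = fun x => flat Φ (x, p.1.2) := rfl
  rw [lapU, sphLaplacian, e, InnerProductSpace.laplacian_eq_iteratedFDeriv_stdOrthonormalBasis]
  refine Finset.sum_congr rfl fun i _ => ?_
  rw [iteratedFDeriv_two_apply]
  set v := stdOrthonormalBasis ℝ (Euc n) i
  simp only [Matrix.cons_val_zero, Matrix.cons_val_one]
  have hdom := mem_flatDom p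
  have hs : ContDiffAt ℝ ∞ (fun x => flat Φ (x, p.1.2)) (p.1.1 : Euc n) :=
    ContDiffAt.comp (g := flat Φ) (f := fun x : Euc n => (x, p.1.2)) _
      (hF.contDiffAt ((flatDom n).isOpen.mem_nhds hdom))
      (contDiffAt_id.prodMk contDiffAt_const)
  have hdd : DifferentiableAt ℝ (fderiv ℝ (fun x => flat Φ (x, p.1.2))) (p.1.1 : Euc n) :=
    (hs.fderiv_right (m := ∞) (by simp)).differentiableAt (by simp)
  have h1 : fderiv ℝ (fderiv ℝ (fun x => flat Φ (x, p.1.2))) (p.1.1 : Euc n) v v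
      = fderiv ℝ (fun x => fderiv ℝ (fun x => flat Φ (x, p.1.2)) x v) (p.1.1 : Euc n) v := by
    rw [fderiv_clm_apply hdd (differentiableAt_const _)]
    simp
  rw [h1, ← fderiv_slice (fderiv_apply_contDiffOn hF (v, 0)) hdom]
  congr 1
  apply Filter.EventuallyEq.fderiv_eq
  have hnear : ∀ᶠ x in nhds (p.1.1 : Euc n), (x, p.1.2) ∈ flatDom n :=
    (Continuous.prodMk_left p.1.2).continuousAt.eventually_mem ((flatDom n).isOpen.mem_nhds hdom)
  filter_upwards [hnear] with x hx
  exact fderiv_slice hF hx v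

/-- An operator that preserves smooth functions and is linear on them. -/
structure IsGood {n : ℕ} [NeZero n] (T : (Y n → ℂ) → (Y n → ℂ)) : Prop where
  smooth : ∀ Φ, IsSmooth Φ → IsSmooth (T Φ)
  add : ∀ Φ Ψ, IsSmooth Φ → IsSmooth Ψ → T (Φ + Ψ) = T Φ + T Ψ
  smul : ∀ (c : ℂ) Φ, IsSmooth Φ → T (c • Φ) = c • T Φ

theorem IsSmooth.add {n : ℕ} [NeZero n] {Φ Ψ : Y n → ℂ} (h : IsSmooth Φ) (h' : IsSmooth Ψ) :
    IsSmooth (Φ + Ψ) := ContMDiff.add h h'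

theorem IsSmooth.smul {n : ℕ} [NeZero n] {Φ : Y n → ℂ} (c : ℂ) (h : IsSmooth Φ) :
    IsSmooth (c • Φ) :=
  ContDiff.comp_contMDiff (g := fun z : ℂ => c • z) (contDiff_const_smul c) h

theorem isSmooth_zero {n : ℕ} [NeZero n] : IsSmooth (0 : Y n → ℂ) := contMDiff_const

theorem IsGood.iterate {n : ℕ} [NeZero n] {T : (Y n → ℂ) → (Y n → ℂ)} (hT : IsGood T) (j : ℕ) :
    IsGood T^[j] := by
  induction j with
  | zero => exact ⟨fun _ h => h, fun _ _ _ _ => rfl, fun _ _ _ => rfl⟩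
  | succ j ih =>
    refine ⟨fun Φ h => ?_, fun Φ Ψ h h' => ?_, fun c Φ h => ?_⟩
    · rw [Function.iterate_succ_apply']; exact hT.smooth _ (ih.smooth _ h)
    · simp only [Function.iterate_succ_apply']
      rw [ih.add _ _ h h', hT.add _ _ (ih.smooth _ h) (ih.smooth _ h')]
    · simp only [Function.iterate_succ_apply']
      rw [ih.smul _ _ h, hT.smul _ _ (ih.smooth _ h)]

theorem flat_add {n : ℕ} (Φ Ψ : Y n → ℂ) : flat (Φ + Ψ) = flat Φ + flat Ψ := by
  funext q
  simp only [flat, radialExt, zeroExt, Pi.add_apply]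
  split_ifs <;> simp

theorem flat_smul {n : ℕ} (c : ℂ) (Φ : Y n → ℂ) : flat (c • Φ) = c • flat Φ := by
  funext q
  simp only [flat, radialExt, zeroExt, Pi.smul_apply]
  split_ifs <;> simp

theorem fderiv_flat_add {n : ℕ} [NeZero n] {Φ Ψ : Y n → ℂ} (h : IsSmooth Φ) (h' : IsSmooth Ψ)
    {q : Euc n × ℝ × ℝ} (hq : q ∈ flatDom n) (v : Euc n × ℝ × ℝ) :
    fderiv ℝ (flat (Φ + Ψ)) q v = fderiv ℝ (flat Φ) q v + fderiv ℝ (flat Ψ) q v := by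
  rw [flat_add, fderiv_add (differentiableAt_of_contDiffOn h.contDiffOn_flat hq)
    (differentiableAt_of_contDiffOn h'.contDiffOn_flat hq)]
  rfl

theorem fderiv_flat_smul {n : ℕ} [NeZero n] (c : ℂ) {Φ : Y n → ℂ} (h : IsSmooth Φ)
    {q : Euc n × ℝ × ℝ} (hq : q ∈ flatDom n) (v : Euc n × ℝ × ℝ) :
    fderiv ℝ (flat (c • Φ)) q v = c • fderiv ℝ (flat Φ) q v := by
  rw [flat_smul, fderiv_const_smul (differentiableAt_of_contDiffOn h.contDiffOn_flat hq) c]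
  rfl

theorem isGood_derivB {n : ℕ} [NeZero n] : IsGood (derivB (n := n)) := by
  refine ⟨fun Φ h => ?_, fun Φ Ψ h h' => ?_, fun c Φ h => ?_⟩
  · rw [funext (derivB_eq h)]
    exact isSmooth_of_contDiffOn (fderiv_apply_contDiffOn h.contDiffOn_flat _)
  · funext p
    rw [Pi.add_apply, derivB_eq (h.add h'), derivB_eq h, derivB_eq h',
      fderiv_flat_add h h' (mem_flatDom p)]
  · funext p
    rw [Pi.smul_apply, derivB_eq (h.smul c), derivB_eq h, fderiv_flat_smul c h (mem_flatDom p)]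

theorem isGood_derivA {n : ℕ} [NeZero n] : IsGood (derivA (n := n)) := by
  refine ⟨fun Φ h => ?_, fun Φ Ψ h h' => ?_, fun c Φ h => ?_⟩
  · rw [funext (derivA_eq h)]
    exact isSmooth_of_contDiffOn (fderiv_apply_contDiffOn h.contDiffOn_flat _)
  · funext p
    rw [Pi.add_apply, derivA_eq (h.add h'), derivA_eq h, derivA_eq h',
      fderiv_flat_add h h' (mem_flatDom p)]
  · funext p
    rw [Pi.smul_apply, derivA_eq (h.smul c), derivA_eq h, fderiv_flat_smul c h (mem_flatDom p)]

theorem isGood_lapU {n : ℕ} [NeZero n] : IsGood (lapU (n := n)) := by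
  refine ⟨fun Φ h => ?_, fun Φ Ψ h h' => ?_, fun c Φ h => ?_⟩
  · rw [funext (lapU_eq h)]
    refine isSmooth_of_contDiffOn (G := fun q => ∑ i : Fin (Module.finrank ℝ (Euc n)), fderiv ℝ
      (fun q => fderiv ℝ (flat Φ) q (stdOrthonormalBasis ℝ (Euc n) i, 0))
      q (stdOrthonormalBasis ℝ (Euc n) i, 0)) ?_
    exact ContDiffOn.sum fun i _ =>
      fderiv_apply_contDiffOn (fderiv_apply_contDiffOn h.contDiffOn_flat _) _
  · funext p
    rw [Pi.add_apply, lapU_eq (h.add h'), lapU_eq h, lapU_eq h', ← Finset.sum_add_distrib]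
    refine Finset.sum_congr rfl fun i _ => ?_
    have hp := mem_flatDom p
    have e : (fun q => fderiv ℝ (flat (Φ + Ψ)) q (stdOrthonormalBasis ℝ (Euc n) i, 0))
        =ᶠ[nhds ((p.1.1 : Euc n), p.1.2)]
        (fun q => fderiv ℝ (flat Φ) q (stdOrthonormalBasis ℝ (Euc n) i, 0)) +
        (fun q => fderiv ℝ (flat Ψ) q (stdOrthonormalBasis ℝ (Euc n) i, 0)) := by
      filter_upwards [(flatDom n).isOpen.mem_nhds hp] with q hq
      exact fderiv_flat_add h h' hq _
    rw [e.fderiv_eq, fderiv_add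
      (differentiableAt_of_contDiffOn (fderiv_apply_contDiffOn h.contDiffOn_flat _) hp)
      (differentiableAt_of_contDiffOn (fderiv_apply_contDiffOn h'.contDiffOn_flat _) hp)]
    rfl
  · funext p
    rw [Pi.smul_apply, lapU_eq (h.smul c), lapU_eq h, Finset.smul_sum]
    refine Finset.sum_congr rfl fun i _ => ?_
    have hp := mem_flatDom p
    have e : (fun q => fderiv ℝ (flat (c • Φ)) q (stdOrthonormalBasis ℝ (Euc n) i, 0))
        =ᶠ[nhds ((p.1.1 : Euc n), p.1.2)]
        c • (fun q => fderiv ℝ (flat Φ) q (stdOrthonormalBasis ℝ (Euc n) i, 0)) := by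
      filter_upwards [(flatDom n).isOpen.mem_nhds hp] with q hq
      exact fderiv_flat_smul c h hq _
    rw [e.fderiv_eq, fderiv_const_smul
      (differentiableAt_of_contDiffOn (fderiv_apply_contDiffOn h.contDiffOn_flat _) hp) c]
    rfl

theorem isGood_mixedDeriv {n : ℕ} [NeZero n] (l m k : ℕ) : IsGood (mixedDeriv (n := n) l m k) := by
  have hA := (isGood_derivA (n := n)).iterate l
  have hB := (isGood_derivB (n := n)).iterate m
  have hL := (isGood_lapU (n := n)).iterate k
  refine ⟨fun Φ h => hA.smooth _ (hB.smooth _ (hL.smooth _ h)), fun Φ Ψ h h' => ?_,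
    fun c Φ h => ?_⟩
  · simp only [mixedDeriv]
    rw [hL.add _ _ h h', hB.add _ _ (hL.smooth _ h) (hL.smooth _ h'),
      hA.add _ _ (hB.smooth _ (hL.smooth _ h)) (hB.smooth _ (hL.smooth _ h'))]
  · simp only [mixedDeriv]
    rw [hL.smul _ _ h, hB.smul _ _ (hL.smooth _ h), hA.smul _ _ (hB.smooth _ (hL.smooth _ h))]

/-! ### The space `𝓢(𝕐ⁿ⁺¹)` -/

theorem weight_nonneg {n : ℕ} (s r : ℕ) (p : Y n) : 0 ≤ weight s r p := by
  have : 0 < p.1.2.2 := p.2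
  unfold weight
  positivity

/-- `Φ` is smooth and all the quantities `ρ_{s,r}^{l,m,k}(Φ)` are finite. -/
def testSubmodule (n : ℕ) [NeZero n] : Submodule ℂ (Y n → ℂ) where
  carrier := {Φ | IsSmooth Φ ∧ ∀ l m k s r : ℕ, ∃ C : ℝ, ∀ p : Y n,
    weight s r p * ‖mixedDeriv l m k Φ p‖ ≤ C}
  zero_mem' := by
    refine ⟨isSmooth_zero, fun l m k s r => ⟨0, fun p => ?_⟩⟩
    have h := (isGood_mixedDeriv (n := n) l m k).smul 0 0 isSmooth_zero
    rw [zero_smul, zero_smul] at h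
    simp [h]
  add_mem' := by
    rintro Φ Ψ ⟨h, hb⟩ ⟨h', hb'⟩
    refine ⟨h.add h', fun l m k s r => ?_⟩
    obtain ⟨C, hC⟩ := hb l m k s r
    obtain ⟨C', hC'⟩ := hb' l m k s r
    refine ⟨C + C', fun p => ?_⟩
    rw [(isGood_mixedDeriv (n := n) l m k).add _ _ h h', Pi.add_apply]
    calc _ ≤ weight s r p * (‖mixedDeriv l m k Φ p‖ + ‖mixedDeriv l m k Ψ p‖) :=
          mul_le_mul_of_nonneg_left (norm_add_le _ _) (weight_nonneg s r p)
      _ ≤ C + C' := by rw [mul_add]; exact add_le_add (hC p) (hC' p)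
  smul_mem' := by
    rintro c Φ ⟨h, hb⟩
    refine ⟨h.smul c, fun l m k s r => ?_⟩
    obtain ⟨C, hC⟩ := hb l m k s r
    refine ⟨‖c‖ * C, fun p => ?_⟩
    rw [(isGood_mixedDeriv (n := n) l m k).smul _ _ h, Pi.smul_apply, norm_smul, mul_left_comm]
    exact mul_le_mul_of_nonneg_left (hC p) (norm_nonneg c)

/-- The space `𝓢(𝕐ⁿ⁺¹)` of highly localized test functions on `𝕐ⁿ⁺¹`. -/
def TestY (n : ℕ) [NeZero n] : Type := ↥(testSubmodule n)

instance instAddCommGroupTestY (n : ℕ) [NeZero n] : AddCommGroup (TestY n) :=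
  inferInstanceAs (AddCommGroup ↥(testSubmodule n))

instance instModuleTestY (n : ℕ) [NeZero n] : Module ℂ (TestY n) :=
  inferInstanceAs (Module ℂ ↥(testSubmodule n))

/-- The underlying function on `𝕐ⁿ⁺¹` of a test function. -/
def TestY.toFun {n : ℕ} [NeZero n] (Φ : TestY n) : Y n → ℂ := Φ.1

theorem TestY.isSmooth {n : ℕ} [NeZero n] (Φ : TestY n) : IsSmooth Φ.toFun := Φ.2.1

theorem TestY.bddAbove {n : ℕ} [NeZero n] (Φ : TestY n) (l m k s r : ℕ) :
    BddAbove (range fun p : Y n => weight s r p * ‖mixedDeriv l m k Φ.toFun p‖) := by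
  obtain ⟨C, hC⟩ := Φ.2.2 l m k s r
  exact ⟨C, by rintro _ ⟨p, rfl⟩; exact hC p⟩

/-- The seminorm `ρ_{s,r}^{l,m,k}(Φ) = sup (aˢ + a⁻ˢ) (1 + b²)^{r/2} |∂_aˡ ∂_bᵐ Δ_uᵏ Φ(u, b, a)|`,
the index being `(l, m, k, s, r)`. -/
def rho (n : ℕ) [NeZero n] : SeminormFamily ℂ (TestY n) (ℕ × ℕ × ℕ × ℕ × ℕ) :=
  fun i => Seminorm.ofSMulLE
    (fun Φ => ⨆ p : Y n, weight i.2.2.2.1 i.2.2.2.2 p *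
      ‖mixedDeriv i.1 i.2.1 i.2.2.1 Φ.toFun p‖)
    (by
      have h := (isGood_mixedDeriv (n := n) i.1 i.2.1 i.2.2.1).smul 0 0 isSmooth_zero
      rw [zero_smul, zero_smul] at h
      have h0 : (0 : TestY n).toFun = 0 := rfl
      simp [h0, h])
    (fun Φ Ψ => by
      have hadd : (Φ + Ψ).toFun = Φ.toFun + Ψ.toFun := rfl
      refine Real.iSup_le (fun p => ?_) (add_nonneg
        (Real.iSup_nonneg fun p => mul_nonneg (weight_nonneg _ _ p) (norm_nonneg _))
        (Real.iSup_nonneg fun p => mul_nonneg (weight_nonneg _ _ p) (norm_nonneg _)))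
      rw [hadd, (isGood_mixedDeriv (n := n) _ _ _).add _ _ Φ.isSmooth Ψ.isSmooth, Pi.add_apply]
      refine (mul_le_mul_of_nonneg_left (norm_add_le _ _) (weight_nonneg _ _ p)).trans ?_
      rw [mul_add]
      exact add_le_add (le_ciSup (Φ.bddAbove i.1 i.2.1 i.2.2.1 i.2.2.2.1 i.2.2.2.2) p)
        (le_ciSup (Ψ.bddAbove i.1 i.2.1 i.2.2.1 i.2.2.2.1 i.2.2.2.2) p))
    (fun c Φ => by
      have hsmul : (c • Φ).toFun = c • Φ.toFun := rfl
      refine Real.iSup_le (fun p => ?_) (mul_nonneg (norm_nonneg c)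
        (Real.iSup_nonneg fun p => mul_nonneg (weight_nonneg _ _ p) (norm_nonneg _)))
      rw [hsmul, (isGood_mixedDeriv (n := n) _ _ _).smul _ _ Φ.isSmooth, Pi.smul_apply, norm_smul,
        mul_left_comm]
      exact mul_le_mul_of_nonneg_left
        (le_ciSup (Φ.bddAbove i.1 i.2.1 i.2.2.1 i.2.2.2.1 i.2.2.2.2) p) (norm_nonneg c))

/-- The locally convex topology of `𝓢(𝕐ⁿ⁺¹)`, defined by the seminorms `ρ_{s,r}^{l,m,k}`. -/
instance instTopologicalSpaceTestY (n : ℕ) [NeZero n] : TopologicalSpace (TestY n) :=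
  (rho n).moduleFilterBasis.topology'

theorem rho_withSeminorms (n : ℕ) [NeZero n] : WithSeminorms (rho n) := ⟨rfl⟩

/-! ### The Lizorkin spaces -/

theorem integrable_of_norm_le_pow {V : Type*} [NormedAddCommGroup V] [NormedSpace ℝ V]
    [FiniteDimensional ℝ V] [MeasurableSpace V] [BorelSpace V] {μ : Measure V}
    [μ.HasTemperateGrowth] (φ : 𝓢(V, ℂ)) {g : V → ℂ} (hg : Continuous g) (j : ℕ)
    (hj : ∀ x, ‖g x‖ ≤ ‖x‖ ^ j) : Integrable (fun x => g x * φ x) μ := by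
  refine (φ.integrable_pow_mul μ j).mono (hg.mul φ.continuous).aestronglyMeasurable
    (Filter.Eventually.of_forall fun x => ?_)
  rw [norm_mul, norm_mul, norm_pow, norm_norm, norm_norm]
  exact mul_le_mul_of_nonneg_right (hj x) (norm_nonneg _)

/-- The monomial `x^m = x₁^{m₁} ⋯ xₙ^{mₙ}`. -/
def monomial {n : ℕ} (m : Fin n → ℕ) (x : Euc n) : ℝ := ∏ i, x i ^ m i

theorem integrable_monomial_mul {n : ℕ} (φ : 𝓢(Euc n, ℂ)) (m : Fin n → ℕ) :
    Integrable (fun x => (monomial m x : ℂ) * φ x) := by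
  refine integrable_of_norm_le_pow φ (g := fun x => (monomial m x : ℂ)) ?_ (∑ i, m i) fun x => ?_
  · unfold monomial; fun_prop
  · rw [Complex.norm_real, monomial, norm_prod, ← Finset.prod_pow_eq_pow_sum]
    refine Finset.prod_le_prod (fun i _ => norm_nonneg _) fun i _ => ?_
    rw [norm_pow]
    exact pow_le_pow_left₀ (norm_nonneg _) (PiLp.norm_apply_le x i) _

/-- The Lizorkin space `𝓢₀(ℝⁿ)` of the Schwartz functions all of whose moments vanish, with the
topology of `𝓢(ℝⁿ)`. -/
def lizorkin (n : ℕ) : Submodule ℂ 𝓢(Euc n, ℂ) where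
  carrier := {φ | ∀ m : Fin n → ℕ, ∫ x, (monomial m x : ℂ) * φ x = 0}
  zero_mem' := fun m => by simp
  add_mem' := by
    intro φ χ h h' m
    simp only [add_apply, mul_add]
    rw [integral_add (integrable_monomial_mul φ m) (integrable_monomial_mul χ m), h m, h' m,
      add_zero]
  smul_mem' := by
    intro c φ h m
    simp only [smul_apply, smul_eq_mul, mul_left_comm _ c]
    rw [integral_const_mul, h m, mul_zero]

theorem integrable_pow_mul_real (φ : 𝓢(ℝ, ℂ)) (m : ℕ) :
    Integrable (fun t : ℝ => ((t ^ m : ℝ) : ℂ) * φ t) := by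
  refine integrable_of_norm_le_pow φ (g := fun t : ℝ => ((t ^ m : ℝ) : ℂ)) ?_ m fun x => ?_
  · fun_prop
  · rw [Complex.norm_real, norm_pow]

/-- The Lizorkin space `𝓢₀(ℝ)` on the real line. -/
def lizorkinReal : Submodule ℂ 𝓢(ℝ, ℂ) where
  carrier := {ψ | ∀ m : ℕ, ∫ t : ℝ, ((t ^ m : ℝ) : ℂ) * ψ t = 0}
  zero_mem' := fun m => by simp
  add_mem' := by
    intro φ χ h h' m
    simp only [add_apply, mul_add]
    rw [integral_add (integrable_pow_mul_real φ m) (integrable_pow_mul_real χ m), h m, h' m,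
      add_zero]
  smul_mem' := by
    intro c φ h m
    simp only [smul_apply, smul_eq_mul, mul_left_comm _ c]
    rw [integral_const_mul, h m, mul_zero]

/-! ### The ridgelet synthesis operator -/

/-- The ridgelet `ψ_{u,b,a}(x) = a⁻¹ ψ((x · u - b) / a)`, with `p = (u, b, a)`. -/
def ridgelet {n : ℕ} (ψ : ℝ → ℂ) (p : Sph n × ℝ × ℝ) (x : Euc n) : ℂ :=
  ((1 / p.2.2 : ℝ) : ℂ) * ψ ((⟪x, (p.1 : Euc n)⟫_ℝ - p.2.1) / p.2.2)

/-- The integrand `Φ(u, b, a) ψ_{u,b,a}(x) a⁻ⁿ` of the synthesis operator. -/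
def synthesisIntegrand {n : ℕ} (Φ : Y n → ℂ) (ψ : ℝ → ℂ) (x : Euc n) (p : Sph n × ℝ × ℝ) : ℂ :=
  zeroExt Φ p * ridgelet ψ p x * ((1 / p.2.2 ^ n : ℝ) : ℂ)

/-- The surface measure on the unit sphere of `ℝⁿ`. -/
def surfaceMeasure (n : ℕ) : Measure (Sph n) := (volume : Measure (Euc n)).toSphere

/-- The ridgelet synthesis operator
`R^t_ψ Φ(x) = ∫_{𝕊ⁿ⁻¹} ∫_0^∞ ∫_{-∞}^∞ Φ(u, b, a) ψ_{u,b,a}(x) a⁻ⁿ db da du`. -/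
def synthesis {n : ℕ} (Φ : Y n → ℂ) (ψ : ℝ → ℂ) (x : Euc n) : ℂ :=
  ∫ u : Sph n, (∫ a in Ioi (0 : ℝ), ∫ b : ℝ, synthesisIntegrand Φ ψ x (u, b, a))
    ∂(surfaceMeasure n)

/-- Absolute convergence of the integral that defines `R^t_ψ Φ(x)`. -/
def SynthesisConverges {n : ℕ} (Φ : Y n → ℂ) (ψ : ℝ → ℂ) (x : Euc n) : Prop :=
  Integrable (synthesisIntegrand Φ ψ x)
    ((surfaceMeasure n).prod
      ((volume : Measure ℝ).prod ((volume : Measure ℝ).restrict (Ioi 0))))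

end

end Ridgelet

/-!
The synthesis operator is a superposition of ridge functions, and the whole argument takes place in
the family

  `T χ Φ (x) = ∫ Φ(u, b, a) aⁱ bʲ χ((x · u - b) / a) du db da`, `i ∈ ℤ`, `j ∈ ℕ`, `χ ∈ 𝓢₀(ℝ)`,

to which `R^t_ψ Φ` belongs with `i = -(n + 1)`, `j = 0`. Since `Φ` and all its multiples by powers
of `a`, `1/a`, `b` are integrable, `T χ Φ` is smooth and each of its derivatives is bounded by
a seminorm of `χ` times a seminorm of `Φ` (`norm_iteratedFDeriv_ridgeInt_le`,
`exists_seminorm_integral_momentWeight_le`).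

Decay comes from the Laplace-Beltrami operator. For a function `w` of one variable and
`t = x · u`,

  `Δ_u [w(x · u)] = (|x|² - t²) w''(t) - (n - 1) t w'(t)`   (`sphLaplacian_sphRidge`),

and `Δ_u` is symmetric on the sphere (`integral_mul_sphLaplacian`). Every `χ ∈ 𝓢₀(ℝ)` is a second
derivative of an element of `𝓢₀(ℝ)`, and taking primitives is continuous there because the moments
vanish (`primitiveL`). With `w'' = χ((t - b) / a)` the formula expresses `|x|² T χ Φ` as a sum of
four functions of the same family, with `Φ` replaced by `Δ_u Φ` in one of them and `χ` by images of
`χ` under continuous operators of `𝓢₀(ℝ)` (`norm_sq_mul_superposition`). By induction all the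
derivatives of `(1 + |x|²)^N T χ Φ` are bounded by products of seminorms
(`isControlled_pow_smul_superposition`); writing `f = (1 + |x|²)^{-N} ((1 + |x|²)^N f)` turns this
into bounds for the Schwartz seminorms of `T χ Φ`, which is what joint continuity of a bilinear map
requires. Putting the powers of `1 + |x|²` inside the derivatives means that `Δ_u` is only
ever applied to `Φ` itself, never to the products `u^α Φ` that differentiation produces.

For the moments, `|u| = 1` gives `T χ Φ = Δ (T χ₂ Φ)`, where `χ₂'' = χ` and the exponent `i` is
raised by two. Integration by parts lowers the degree of a monomial by two, so that all moments
vanish by induction on the degree (`integral_monomial_mul_superposition`).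
-/

namespace Ridgelet

noncomputable section

/-! ### Recovering decay from bounds on `(1 + |x|²)^N f` -/

/-- A high power of `(1 + |x|²)⁻¹` decays, together with its derivatives up to order `m`, faster than
`|x|⁻ᵏ`. -/
theorem exists_norm_pow_mul_iteratedFDeriv_inv_pow_le (E : Type*) [NormedAddCommGroup E]
    [InnerProductSpace ℝ E] (k m : ℕ) : ∃ (N : ℕ) (C : ℝ), 0 ≤ C ∧ ∀ i ≤ m, ∀ x : E,
      ‖x‖ ^ k * ‖iteratedFDeriv ℝ i (fun y : E => (1 + ‖y‖ ^ 2)⁻¹ ^ N) x‖ ≤ C := by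
  have htemp := Function.hasTemperateGrowth_one_add_norm_sq_rpow (H := E) (-1)
  have hfun : (fun x : E => (1 + ‖x‖ ^ 2) ^ (-1 : ℝ)) = fun x : E => (1 + ‖x‖ ^ 2)⁻¹ := by
    funext x
    rw [Real.rpow_neg_one]
  rw [hfun] at htemp
  obtain ⟨j, C, hC0, hC⟩ := htemp.norm_iteratedFDeriv_le_uniform m
  -- Every derivative that falls on the `N`-th power costs one factor `(1 + |y|²)⁻¹`, at most `m`
  -- in total, while the inner derivatives produce at most the growth `(1 + |y|)^(j m)`.
  set M := j * m + k with hM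
  refine ⟨M + m, (m.factorial * (M + m : ℕ) ^ m) * ((1 + C) ^ m * 2 ^ M), by positivity, ?_⟩
  intro i hi x
  set h : ℝ := (1 + ‖x‖ ^ 2)⁻¹ with hh
  have hx0 : 0 ≤ ‖x‖ := norm_nonneg x
  have hpos : 0 < 1 + ‖x‖ ^ 2 := by positivity
  have h0 : 0 < h := inv_pos.2 hpos
  have h1 : h ≤ 1 := inv_le_one_of_one_le₀ (by nlinarith)
  have hcomp : (fun y : E => (1 + ‖y‖ ^ 2)⁻¹ ^ (M + m))
      = (fun t : ℝ => t ^ (M + m)) ∘ fun y : E => (1 + ‖y‖ ^ 2)⁻¹ := rfl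
  rw [hcomp]
  have hfac : 1 ≤ (1 + C) * (1 + ‖x‖) ^ j := by
    have := one_le_pow₀ (M₀ := ℝ) (a := 1 + ‖x‖) (by linarith) (n := j)
    nlinarith
  have hb := norm_iteratedFDeriv_comp_le (g := fun t : ℝ => t ^ (M + m))
    (f := fun y : E => (1 + ‖y‖ ^ 2)⁻¹) (n := i) (N := ∞) (by fun_prop) htemp.1
    (by exact_mod_cast le_top) x (C := (M + m : ℕ) ^ m * h ^ M)
    (D := (1 + C) * (1 + ‖x‖) ^ j)
    (fun l hl => by
      rw [norm_iteratedFDeriv_eq_norm_iteratedDeriv, iteratedDeriv_pow, norm_mul, norm_pow,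
        Real.norm_of_nonneg h0.le, Real.norm_of_nonneg (Nat.cast_nonneg _)]
      refine mul_le_mul ?_ (pow_le_pow_of_le_one h0.le h1 (by omega)) (by positivity)
        (by positivity)
      calc ((M + m).descFactorial l : ℝ) ≤ ((M + m : ℕ) : ℝ) ^ l := by
            exact_mod_cast Nat.descFactorial_le_pow _ _
        _ ≤ ((M + m : ℕ) : ℝ) ^ m := by
            rcases Nat.eq_zero_or_pos (M + m) with h | h
            · have : l = 0 := by omega
              have : m = 0 := by omega
              simp_all
            · exact pow_le_pow_right₀ (by exact_mod_cast h) (hl.trans hi))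
    (fun l hl1 hl => by
      refine (hC l (hl.trans hi) x).trans (le_trans ?_ (le_self_pow₀ hfac (by omega)))
      gcongr
      linarith)
  have hsq : (1 + ‖x‖) ^ 2 ≤ 2 * (1 + ‖x‖ ^ 2) := by nlinarith [sq_nonneg (1 - ‖x‖)]
  have hgrow : (1 + ‖x‖) ^ M * h ^ M ≤ 2 ^ M := by
    rw [← mul_pow]
    refine pow_le_pow_left₀ (by positivity) ?_ _
    calc (1 + ‖x‖) * h ≤ (1 + ‖x‖) ^ 2 * h := by gcongr; nlinarith
      _ ≤ 2 * (1 + ‖x‖ ^ 2) * h := by gcongr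
      _ = 2 := by rw [hh]; field_simp
  have hD : ((1 + C) * (1 + ‖x‖) ^ j) ^ i ≤ (1 + C) ^ m * (1 + ‖x‖) ^ (j * m) := by
    refine (pow_le_pow_right₀ hfac hi).trans (le_of_eq ?_)
    rw [mul_pow, ← pow_mul]
  calc ‖x‖ ^ k * _ ≤ (1 + ‖x‖) ^ k * (i.factorial * ((M + m : ℕ) ^ m * h ^ M) *
        ((1 + C) * (1 + ‖x‖) ^ j) ^ i) := by gcongr; linarith
    _ ≤ (1 + ‖x‖) ^ k * (m.factorial * ((M + m : ℕ) ^ m * h ^ M) *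
        ((1 + C) ^ m * (1 + ‖x‖) ^ (j * m))) := by gcongr
    _ = (m.factorial * (M + m : ℕ) ^ m) * ((1 + C) ^ m * ((1 + ‖x‖) ^ M * h ^ M)) := by
        rw [hM, pow_add (1 + ‖x‖)]; ring
    _ ≤ _ := by gcongr

/-- If all derivatives up to order `m` of `(1 + |x|²)^N f` are bounded, for `N` large in terms of
`k` and `m`, then `|x|^k D^m f` is bounded. -/
theorem exists_norm_pow_mul_iteratedFDeriv_le (E : Type*) [NormedAddCommGroup E]
    [InnerProductSpace ℝ E] (k m : ℕ) : ∃ (N : ℕ) (C : ℝ), 0 ≤ C ∧ ∀ (f : E → ℂ) (B : ℕ → ℝ),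
      ContDiff ℝ ∞ f →
      (∀ i ≤ m, ∀ x, ‖iteratedFDeriv ℝ i (fun y => (1 + ‖y‖ ^ 2) ^ N • f y) x‖ ≤ B i) →
      ∀ x, ‖x‖ ^ k * ‖iteratedFDeriv ℝ m f x‖ ≤ C * ∑ i ∈ Finset.range (m + 1), B i := by
  obtain ⟨N, C, hC0, hC⟩ := exists_norm_pow_mul_iteratedFDeriv_inv_pow_le E k m
  refine ⟨N, 2 ^ m * C, by positivity, fun f B hf hB x => ?_⟩
  have hnz : ∀ y : E, (1 + ‖y‖ ^ 2) ≠ 0 := fun y => by positivity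
  have hns : ContDiff ℝ ∞ fun y : E => 1 + ‖y‖ ^ 2 := contDiff_const.add (contDiff_norm_sq ℝ)
  have hfe : f = fun y => (1 + ‖y‖ ^ 2)⁻¹ ^ N • ((1 + ‖y‖ ^ 2) ^ N • f y) := by
    funext y
    rw [smul_smul, ← mul_pow, inv_mul_cancel₀ (hnz y), one_pow, one_smul]
  have h := norm_iteratedFDeriv_smul_le (𝕜 := ℝ) (N := ∞) (n := m)
    (f := fun y : E => (1 + ‖y‖ ^ 2)⁻¹ ^ N) (g := fun y => (1 + ‖y‖ ^ 2) ^ N • f y)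
    ((hns.inv hnz).pow N) ((hns.pow N).smul hf) x (by exact_mod_cast le_top)
  rw [← hfe] at h
  have hBnn : ∀ i ≤ m, 0 ≤ B i := fun i hi => (norm_nonneg _).trans (hB i hi 0)
  refine (mul_le_mul_of_nonneg_left h (by positivity)).trans ?_
  rw [Finset.mul_sum]
  calc _ = ∑ i ∈ Finset.range (m + 1), (m.choose i : ℝ) *
          (‖x‖ ^ k * ‖iteratedFDeriv ℝ i (fun y : E => (1 + ‖y‖ ^ 2)⁻¹ ^ N) x‖) *
          ‖iteratedFDeriv ℝ (m - i) (fun y => (1 + ‖y‖ ^ 2) ^ N • f y) x‖ := by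
        exact Finset.sum_congr rfl fun i _ => by ring
    _ ≤ ∑ i ∈ Finset.range (m + 1), 2 ^ m * C * B (m - i) := by
        refine Finset.sum_le_sum fun i hi => ?_
        have hi' : i ≤ m := by simpa [Nat.lt_succ_iff] using hi
        have hchoose : (m.choose i : ℝ) ≤ 2 ^ m := by exact_mod_cast Nat.choose_le_two_pow m i
        exact mul_le_mul (mul_le_mul hchoose (hC i hi' x) (by positivity) (by positivity))
          (hB _ (Nat.sub_le _ _) x) (norm_nonneg _) (by positivity)
    _ = 2 ^ m * C * ∑ i ∈ Finset.range (m + 1), B i := by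
        rw [← Finset.mul_sum]
        congr 1
        exact Finset.sum_range_reflect B (m + 1)

/-! ### Operators on the Lizorkin space of the line -/

/-- The primitive `t ↦ ∫_{-∞}^t χ`. -/
def primitive (χ : 𝓢(ℝ, ℂ)) (t : ℝ) : ℂ := ∫ s in Iic t, χ s

theorem hasDerivAt_primitive (χ : 𝓢(ℝ, ℂ)) (t : ℝ) : HasDerivAt (primitive χ) (χ t) t := by
  have e : primitive χ = fun t => primitive χ 0 + ∫ s in (0 : ℝ)..t, χ s := by
    funext t
    rw [primitive, primitive,
      ← intervalIntegral.integral_Iic_sub_Iic χ.integrable.integrableOn χ.integrable.integrableOn]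
    ring
  rw [e]
  exact (intervalIntegral.integral_hasDerivAt_right (χ.continuous.intervalIntegrable _ _)
    (χ.continuous.stronglyMeasurableAtFilter _ _) χ.continuous.continuousAt).const_add _

theorem deriv_primitive (χ : 𝓢(ℝ, ℂ)) : deriv (primitive χ) = χ :=
  funext fun t => (hasDerivAt_primitive χ t).deriv

theorem contDiff_primitive (χ : 𝓢(ℝ, ℂ)) : ContDiff ℝ ∞ (primitive χ) := by
  rw [contDiff_infty_iff_deriv, deriv_primitive]
  exact ⟨fun t => (hasDerivAt_primitive χ t).differentiableAt, χ.smooth _⟩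

/-- Vanishing of the integral allows one to integrate over the half-line on the far side of `t`,
where `|t| ≤ |s|`. -/
theorem norm_pow_mul_primitive_le {χ : 𝓢(ℝ, ℂ)} (hχ : ∫ s, χ s = 0) (k : ℕ) (t : ℝ) :
    ‖t‖ ^ k * ‖primitive χ t‖ ≤ ∫ s, ‖s‖ ^ k * ‖χ s‖ := by
  have hint := χ.integrable_pow_mul volume k
  have key : ∀ S : Set ℝ, MeasurableSet S → (∀ s ∈ S, ‖t‖ ≤ ‖s‖) →
      ‖t‖ ^ k * ‖∫ s in S, χ s‖ ≤ ∫ s, ‖s‖ ^ k * ‖χ s‖ := by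
    intro S hS hts
    calc ‖t‖ ^ k * ‖∫ s in S, χ s‖ ≤ ‖t‖ ^ k * ∫ s in S, ‖χ s‖ := by
          gcongr; exact norm_integral_le_integral_norm _
      _ = ∫ s in S, ‖t‖ ^ k * ‖χ s‖ := (integral_const_mul _ _).symm
      _ ≤ ∫ s in S, ‖s‖ ^ k * ‖χ s‖ := by
          refine setIntegral_mono_on (χ.integrable.norm.const_mul _).integrableOn
            hint.integrableOn hS fun s hs => ?_
          have := hts s hs
          gcongr
      _ ≤ ∫ s, ‖s‖ ^ k * ‖χ s‖ :=
          setIntegral_le_integral hint (Filter.Eventually.of_forall fun s => by positivity)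
  rcases le_total t 0 with ht | ht
  · refine key (Iic t) measurableSet_Iic fun s hs => ?_
    rw [Real.norm_eq_abs, Real.norm_eq_abs, abs_of_nonpos ht, abs_of_nonpos (le_trans hs ht)]
    exact neg_le_neg hs
  · have h := intervalIntegral.integral_Iic_add_Ioi (b := t) χ.integrable.integrableOn
      χ.integrable.integrableOn (μ := volume)
    rw [hχ] at h
    have e : primitive χ t = -∫ s in Ioi t, χ s := eq_neg_of_add_eq_zero_left h
    rw [e, norm_neg]
    refine key (Ioi t) measurableSet_Ioi fun s hs => ?_
    rw [Real.norm_eq_abs, Real.norm_eq_abs, abs_of_nonneg ht, abs_of_nonneg (ht.trans (le_of_lt hs))]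
    exact le_of_lt hs

theorem norm_iteratedFDeriv_primitive_succ (χ : 𝓢(ℝ, ℂ)) (n : ℕ) (t : ℝ) :
    ‖iteratedFDeriv ℝ (n + 1) (primitive χ) t‖ = ‖iteratedFDeriv ℝ n χ t‖ := by
  rw [norm_iteratedFDeriv_eq_norm_iteratedDeriv, norm_iteratedFDeriv_eq_norm_iteratedDeriv,
    iteratedDeriv_succ', deriv_primitive]

/-- The primitive of a Schwartz function of integral zero, as a Schwartz function. -/
def schwartzPrimitive (χ : 𝓢(ℝ, ℂ)) (hχ : ∫ s, χ s = 0) : 𝓢(ℝ, ℂ) where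
  toFun := primitive χ
  smooth' := contDiff_primitive χ
  decay' := by
    intro k n
    cases n with
    | zero => exact ⟨_, fun t => by simpa using norm_pow_mul_primitive_le hχ k t⟩
    | succ n =>
      obtain ⟨C, -, hC⟩ := χ.decay k n
      exact ⟨C, fun t => by rw [norm_iteratedFDeriv_primitive_succ]; exact hC t⟩

theorem integral_eq_zero_of_mem_lizorkinReal (χ : lizorkinReal) : ∫ s, χ.1 s = 0 := by
  simpa using χ.2 0

theorem schwartzPrimitive_mem_lizorkinReal (χ : lizorkinReal) :
    schwartzPrimitive χ.1 (integral_eq_zero_of_mem_lizorkinReal χ) ∈ lizorkinReal := by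
  intro m
  set I := schwartzPrimitive χ.1 (integral_eq_zero_of_mem_lizorkinReal χ) with hI
  have hu : ∀ t : ℝ, HasDerivAt (fun t : ℝ => ((t ^ (m + 1) : ℝ) : ℂ))
      (((m + 1 : ℕ) : ℂ) * ((t ^ m : ℝ) : ℂ)) t := fun t => by
    have := (hasDerivAt_pow (m + 1) t).ofReal_comp
    simpa using this
  have h := integral_mul_deriv_eq_deriv_mul_of_integrable (fun t _ => hu t)
    (fun t _ => hasDerivAt_primitive χ.1 t) (integrable_pow_mul_real χ.1 (m + 1))
    (by
      have := (integrable_pow_mul_real I m).const_mul ((m + 1 : ℕ) : ℂ)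
      exact this.congr (Filter.Eventually.of_forall fun t => (mul_assoc _ _ _).symm))
    (integrable_pow_mul_real I (m + 1))
  rw [χ.2 (m + 1)] at h
  simp only [mul_assoc] at h
  rw [integral_const_mul, eq_comm, neg_eq_zero, mul_eq_zero] at h
  exact h.resolve_left (by exact_mod_cast Nat.succ_ne_zero m)

theorem withSeminorms_lizorkinReal : WithSeminorms
    ((schwartzSeminormFamily ℂ ℝ ℂ).comp lizorkinReal.subtype) :=
  LinearMap.withSeminorms_induced (schwartz_withSeminorms ℂ ℝ ℂ) lizorkinReal.subtype

theorem continuous_seminorm_lizorkinReal (k n : ℕ) :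
    Continuous ((SchwartzMap.seminorm ℂ k n (E := ℝ) (F := ℂ)).comp lizorkinReal.subtype) :=
  withSeminorms_lizorkinReal.continuous_seminorm (k, n)

/-- The primitive as a linear map of the Lizorkin space. -/
def primitiveLM : lizorkinReal →ₗ[ℂ] lizorkinReal where
  toFun χ := ⟨_, schwartzPrimitive_mem_lizorkinReal χ⟩
  map_add' χ χ' := by
    ext t
    exact integral_add χ.1.integrable.integrableOn χ'.1.integrable.integrableOn
  map_smul' c χ := by
    ext t
    exact integral_const_mul _ _

theorem continuous_primitiveLM : Continuous primitiveLM := by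
  refine withSeminorms_lizorkinReal.continuous_of_continuous_comp _ fun i => ?_
  obtain ⟨k, n⟩ := i
  cases n with
  | succ n =>
    refine Seminorm.continuous_of_le (continuous_seminorm_lizorkinReal k n) fun χ => ?_
    refine SchwartzMap.seminorm_le_bound ℂ k (n + 1) _ (apply_nonneg _ _) fun t => ?_
    refine (le_of_eq ?_).trans (SchwartzMap.le_seminorm ℂ k n χ.1 t)
    exact congrArg (‖t‖ ^ k * ·) (norm_iteratedFDeriv_primitive_succ χ.1 n t)
  | zero =>
    set μ := (volume : Measure ℝ)
    set C : NNReal := Real.toNNReal (2 ^ μ.integrablePower *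
      (∫ x : ℝ, (1 + ‖x‖) ^ (-(μ.integrablePower : ℝ)) ∂μ)) with hC
    have hC0 : 0 ≤ 2 ^ μ.integrablePower *
      (∫ x : ℝ, (1 + ‖x‖) ^ (-(μ.integrablePower : ℝ)) ∂μ) :=
      mul_nonneg (by positivity) (integral_nonneg fun x => by positivity)
    have hcont := ((continuous_seminorm_lizorkinReal 0 0).add
      (continuous_seminorm_lizorkinReal (k + μ.integrablePower) 0)).const_smul C
    refine Seminorm.continuous_of_le (q := C •
      ((SchwartzMap.seminorm ℂ 0 0 (E := ℝ) (F := ℂ)).comp lizorkinReal.subtype +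
      (SchwartzMap.seminorm ℂ (k + μ.integrablePower) 0 (E := ℝ) (F := ℂ)).comp
        lizorkinReal.subtype)) hcont fun χ => ?_
    refine SchwartzMap.seminorm_le_bound ℂ k 0 _ (apply_nonneg _ _) fun t => ?_
    have h1 := norm_pow_mul_primitive_le (integral_eq_zero_of_mem_lizorkinReal χ) k t
    have h2 := SchwartzMap.integral_pow_mul_iteratedFDeriv_le ℂ μ χ.1 k 0
    simp only [norm_iteratedFDeriv_zero] at h2 ⊢
    refine h1.trans (h2.trans (le_of_eq ?_))
    rw [← Real.coe_toNNReal _ hC0]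
    rfl

/-- The continuous operator `χ ↦ ∫_{-∞}^t χ` on `𝓢₀(ℝ)`. -/
def primitiveL : lizorkinReal →L[ℂ] lizorkinReal := ⟨primitiveLM, continuous_primitiveLM⟩

theorem hasDerivAt_primitiveL (χ : lizorkinReal) (t : ℝ) :
    HasDerivAt (primitiveL χ).1 (χ.1 t) t := hasDerivAt_primitive χ.1 t

/-- The continuous operator `χ ↦ t χ` on `𝓢₀(ℝ)`. -/
def mulL : lizorkinReal →L[ℂ] lizorkinReal :=
  ((SchwartzMap.smulLeftCLM ℂ (fun t : ℝ => (t : ℂ))).comp lizorkinReal.subtypeL).codRestrict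
    lizorkinReal (fun χ m => by
      have h := χ.2 (m + 1)
      rw [← h]
      refine integral_congr_ae (Filter.Eventually.of_forall fun t => ?_)
      simp only [ContinuousLinearMap.comp_apply, Submodule.subtypeL_apply]
      rw [SchwartzMap.smulLeftCLM_apply_apply Function.Complex.hasTemperateGrowth_ofReal]
      push_cast
      rw [smul_eq_mul]
      ring)

theorem mulL_apply (χ : lizorkinReal) (t : ℝ) : (mulL χ).1 t = t * χ.1 t :=
  SchwartzMap.smulLeftCLM_apply_apply Function.Complex.hasTemperateGrowth_ofReal χ.1 t

/-! ### Green's formula on the sphere -/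

theorem integral_fderiv_apply_eq_zero {n : ℕ} {H : Euc n → ℂ} (hH : ContDiff ℝ 1 H)
    (hc : HasCompactSupport H) (v : Euc n) : ∫ y, fderiv ℝ H y v = 0 := by
  have hcd : Continuous fun y => fderiv ℝ H y v :=
    (hH.continuous_fderiv (by simp)).clm_apply continuous_const
  have hcs : HasCompactSupport fun y => fderiv ℝ H y v := hc.fderiv_apply (𝕜 := ℝ) v
  have h := integral_mul_fderiv_eq_neg_fderiv_mul_of_integrable (μ := (volume : Measure (Euc n)))
    (f := fun _ => (1 : ℂ)) (g := H) (v := v) (by simp)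
    (by simpa using hcd.integrable_of_hasCompactSupport hcs)
    (by simpa using hH.continuous.integrable_of_hasCompactSupport hc)
    (fun _ _ => differentiableAt_const _) (fun _ _ => hH.differentiable (by simp) _)
  simpa using h

/-- A bump function of one variable supported in `[1/2, 3/2]`. -/
def radialBump : ContDiffBump (1 : ℝ) := ⟨1 / 4, 1 / 2, by norm_num, by norm_num⟩

/-- A smooth compactly supported radial function on `ℝⁿ` which vanishes near the origin. -/
def radialCutoff {n : ℕ} (y : Euc n) : ℝ := radialBump (‖y‖ ^ 2)

theorem contDiff_radialCutoff {n : ℕ} : ContDiff ℝ ∞ (radialCutoff (n := n)) :=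
  radialBump.contDiff.comp (contDiff_norm_sq ℝ)

theorem tsupport_radialCutoff_subset {n : ℕ} :
    tsupport (radialCutoff (n := n)) ⊆ {y | 1 / 2 ≤ ‖y‖ ^ 2 ∧ ‖y‖ ^ 2 ≤ 3 / 2} := by
  refine closure_minimal (fun y hy => ?_) ?_
  · have h : ‖y‖ ^ 2 ∈ Function.support radialBump := hy
    rw [radialBump.support_eq, Real.ball_eq_Ioo] at h
    have h1 : radialBump.rOut = 1 / 2 := rfl
    rw [h1] at h
    exact ⟨by linarith [h.1], by linarith [h.2]⟩
  · have hc : Continuous fun y : Euc n => ‖y‖ ^ 2 := by fun_prop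
    exact (isClosed_le continuous_const hc).inter (isClosed_le hc continuous_const)

theorem ne_zero_of_mem_tsupport_radialCutoff {n : ℕ} {y : Euc n}
    (hy : y ∈ tsupport (radialCutoff (n := n))) : y ≠ 0 := by
  rintro rfl
  have := (tsupport_radialCutoff_subset hy).1
  norm_num at this

theorem hasCompactSupport_radialCutoff {n : ℕ} : HasCompactSupport (radialCutoff (n := n)) := by
  refine HasCompactSupport.of_support_subset_isCompact (isCompact_closedBall (0 : Euc n) 2)
    fun y hy => ?_
  have := (tsupport_radialCutoff_subset (subset_tsupport _ hy)).2
  rw [mem_closedBall_zero_iff]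
  nlinarith [norm_nonneg y]

theorem fderiv_radialCutoff {n : ℕ} (y v : Euc n) :
    fderiv ℝ radialCutoff y v = deriv radialBump (‖y‖ ^ 2) * (2 * ⟪y, v⟫_ℝ) := by
  have h1 : HasDerivAt radialBump (deriv radialBump (‖y‖ ^ 2)) (‖y‖ ^ 2) :=
    (radialBump.contDiff (n := 1).differentiable (by simp) _).hasDerivAt
  have h2 := h1.comp_hasFDerivAt y (hasStrictFDerivAt_norm_sq y).hasFDerivAt
  have h3 : HasFDerivAt radialCutoff _ y := h2
  rw [h3.fderiv]
  simp only [smul_apply, smul_eq_mul, nsmul_eq_mul, innerSL_apply_apply]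
  push_cast
  ring

/-- Multiplication by the radial cutoff makes a function that is smooth off the origin smooth. -/
theorem contDiff_radialCutoff_mul {n : ℕ} {K : Euc n → ℂ} (hK : ContDiffOn ℝ ∞ K {0}ᶜ) :
    ContDiff ℝ ∞ fun y => (radialCutoff y : ℂ) * K y := by
  refine contDiff_iff_contDiffAt.2 fun y => ?_
  by_cases hy : y ∈ tsupport (radialCutoff (n := n))
  · have h0 := ne_zero_of_mem_tsupport_radialCutoff hy
    exact (Complex.ofRealCLM.contDiff.comp contDiff_radialCutoff).contDiffAt.mul
      (hK.contDiffAt (isOpen_compl_singleton.mem_nhds h0))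
  · refine (contDiffAt_const (c := (0 : ℂ))).congr_of_eventuallyEq ?_
    filter_upwards [notMem_tsupport_iff_eventuallyEq.1 hy] with z hz
    simp [hz]

theorem hasCompactSupport_radialCutoff_mul {n : ℕ} (K : Euc n → ℂ) :
    HasCompactSupport fun y => (radialCutoff y : ℂ) * K y :=
  HasCompactSupport.mul_right
    (hasCompactSupport_radialCutoff.comp_left (g := fun t : ℝ => (t : ℂ)) (by simp))

theorem laplacian_eq_sum_fderiv {n : ℕ} {f : Euc n → ℂ} {y : Euc n} (hf : ContDiffAt ℝ ∞ f y) :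
    Laplacian.laplacian f y = ∑ i : Fin n, fderiv ℝ
      (fun z => fderiv ℝ f z (EuclideanSpace.basisFun (Fin n) ℝ i)) y
      (EuclideanSpace.basisFun (Fin n) ℝ i) := by
  rw [InnerProductSpace.laplacian_eq_iteratedFDeriv_orthonormalBasis f
    (EuclideanSpace.basisFun (Fin n) ℝ)]
  refine Finset.sum_congr rfl fun i _ => ?_
  rw [iteratedFDeriv_two_apply, fderiv_clm_apply
    ((hf.fderiv_right (m := ∞) (by simp)).differentiableAt (by simp)) (differentiableAt_const _)]
  simp

theorem contDiffOn_fderiv_apply {n : ℕ} {f : Euc n → ℂ} (hf : ContDiffOn ℝ ∞ f {0}ᶜ) (v : Euc n) :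
    ContDiffOn ℝ ∞ (fun z => fderiv ℝ f z v) {0}ᶜ :=
  (hf.fderiv_of_isOpen isOpen_compl_singleton (m := ∞) (by simp)).clm_apply contDiffOn_const

theorem contDiffOn_laplacian {n : ℕ} {f : Euc n → ℂ} (hf : ContDiffOn ℝ ∞ f {0}ᶜ) :
    ContDiffOn ℝ ∞ (Laplacian.laplacian f) {0}ᶜ := by
  refine (ContDiffOn.sum (s := Finset.univ) fun i _ =>
    contDiffOn_fderiv_apply (contDiffOn_fderiv_apply hf
      (EuclideanSpace.basisFun (Fin n) ℝ i)) (EuclideanSpace.basisFun (Fin n) ℝ i)).congr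
    fun y hy => ?_
  exact laplacian_eq_sum_fderiv (hf.contDiffAt (isOpen_compl_singleton.mem_nhds hy))

/-- `f` is positively homogeneous of degree `0`, that is, constant along rays. -/
def IsRadiallyConst {n : ℕ} (f : Euc n → ℂ) : Prop := ∀ (c : ℝ) (y : Euc n), 0 < c → f (c • y) = f y

/-- Euler's relation in degree `0`. -/
theorem IsRadiallyConst.fderiv_self {n : ℕ} {f : Euc n → ℂ} (hf : IsRadiallyConst f) {y : Euc n}
    (hd : DifferentiableAt ℝ f y) : fderiv ℝ f y y = 0 := by
  have hc : HasDerivAt (fun c : ℝ => c • y) y 1 := by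
    simpa using (hasDerivAt_id (1 : ℝ)).smul_const y
  have hd' : HasFDerivAt f (fderiv ℝ f y) ((1 : ℝ) • y) := by rw [one_smul]; exact hd.hasFDerivAt
  have h := hd'.comp_hasDerivAt (1 : ℝ) hc
  have h' : HasDerivAt (f ∘ fun c : ℝ => c • y) 0 1 := by
    refine (hasDerivAt_const (1 : ℝ) (f y)).congr_of_eventuallyEq ?_
    filter_upwards [lt_mem_nhds zero_lt_one] with c hc using hf c y hc
  exact h.unique h'

/-- The Laplacian lowers the degree of homogeneity by two. -/
theorem IsRadiallyConst.laplacian_smul {n : ℕ} {f : Euc n → ℂ} (hf : IsRadiallyConst f) {c : ℝ}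
    (hc : 0 < c) (y : Euc n) :
    ((c ^ 2 : ℝ) : ℂ) * Laplacian.laplacian f (c • y) = Laplacian.laplacian f y := by
  have e0 : (fun z => f (c • z)) = f := funext fun z => hf c z hc
  have e1 : fderiv ℝ f = fun z => c • fderiv ℝ f (c • z) := by
    funext z
    conv_lhs => rw [← e0]
    exact fderiv_comp_smul c
  have e2 : fderiv ℝ (fderiv ℝ f) y = c • c • fderiv ℝ (fderiv ℝ f) (c • y) := by
    conv_lhs => rw [e1]
    rw [← fderiv_comp_smul (f := fderiv ℝ f) c]
    exact congrFun (fderiv_const_smul_field (𝕜 := ℝ) (f := fun z => fderiv ℝ f (c • z)) c) y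
  rw [InnerProductSpace.laplacian_eq_iteratedFDeriv_orthonormalBasis f
    (EuclideanSpace.basisFun (Fin n) ℝ), Finset.mul_sum]
  refine Finset.sum_congr rfl fun i _ => ?_
  rw [iteratedFDeriv_two_apply, iteratedFDeriv_two_apply, e2]
  simp only [smul_apply, Complex.real_smul]
  push_cast
  ring

theorem sum_basisFun_mul_fderiv {n : ℕ} (f : Euc n → ℂ) (y : Euc n) :
    ∑ i : Fin n, ((⟪y, EuclideanSpace.basisFun (Fin n) ℝ i⟫_ℝ : ℝ) : ℂ) *
      fderiv ℝ f y (EuclideanSpace.basisFun (Fin n) ℝ i) = fderiv ℝ f y y := by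
  conv_rhs => arg 2; rw [← (EuclideanSpace.basisFun (Fin n) ℝ).sum_repr' y]
  rw [map_sum]
  refine Finset.sum_congr rfl fun i _ => ?_
  rw [map_smul, Complex.real_smul, real_inner_comm]

/-- Green's formula in `ℝⁿ` with a radial cutoff: its derivative does not contribute, because
functions that are constant along rays have tangential gradients. -/
theorem integral_radialCutoff_mul_green {n : ℕ} {f g : Euc n → ℂ}
    (hf : ContDiffOn ℝ ∞ f {0}ᶜ) (hg : ContDiffOn ℝ ∞ g {0}ᶜ)
    (hf0 : IsRadiallyConst f) (hg0 : IsRadiallyConst g) :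
    ∫ y : Euc n, (radialCutoff y : ℂ) *
      (f y * Laplacian.laplacian g y - g y * Laplacian.laplacian f y) = 0 := by
  set e := EuclideanSpace.basisFun (Fin n) ℝ with he
  set W : Fin n → Euc n → ℂ := fun i y =>
    f y * fderiv ℝ g y (e i) - g y * fderiv ℝ f y (e i) with hW
  have hWs : ∀ i, ContDiffOn ℝ ∞ (W i) {0}ᶜ := fun i =>
    (hf.mul (contDiffOn_fderiv_apply hg _)).sub (hg.mul (contDiffOn_fderiv_apply hf _))
  have hH := fun i => contDiff_radialCutoff_mul (hWs i)
  have hHc := fun i => hasCompactSupport_radialCutoff_mul (W i)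
  have hsum : ∀ y : Euc n, (radialCutoff y : ℂ) *
      (f y * Laplacian.laplacian g y - g y * Laplacian.laplacian f y)
      = ∑ i, fderiv ℝ (fun y => (radialCutoff y : ℂ) * W i y) y (e i) := by
    intro y
    by_cases hy : y = 0
    · have hz : ∀ᶠ z in nhds y, radialCutoff z = 0 := by
        have : y ∉ tsupport (radialCutoff (n := n)) := fun h =>
          ne_zero_of_mem_tsupport_radialCutoff h hy
        exact notMem_tsupport_iff_eventuallyEq.1 this
      have hz' : ∀ i, fderiv ℝ (fun y => (radialCutoff y : ℂ) * W i y) y = 0 := by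
        intro i
        have : (fun y => (radialCutoff y : ℂ) * W i y) =ᶠ[nhds y] fun _ => 0 := by
          filter_upwards [hz] with z hz using by simp [hz]
        rw [this.fderiv_eq]; simp
      simp [hz.self_of_nhds, hz']
    · have hmem : ({0}ᶜ : Set (Euc n)) ∈ nhds y := isOpen_compl_singleton.mem_nhds hy
      have hfd := (hf.contDiffAt hmem).differentiableAt (by simp)
      have hgd := (hg.contDiffAt hmem).differentiableAt (by simp)
      have hη : HasFDerivAt (fun y : Euc n => (radialCutoff y : ℂ))
          (Complex.ofRealCLM.comp (fderiv ℝ radialCutoff y)) y :=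
        Complex.ofRealCLM.hasFDerivAt.comp y
          (contDiff_radialCutoff.differentiable (by simp) y).hasFDerivAt
      have hterm : ∀ i, fderiv ℝ (fun y => (radialCutoff y : ℂ) * W i y) y (e i)
          = (radialCutoff y : ℂ) * (f y * fderiv ℝ (fun z => fderiv ℝ g z (e i)) y (e i)
              - g y * fderiv ℝ (fun z => fderiv ℝ f z (e i)) y (e i))
            + ((deriv radialBump (‖y‖ ^ 2) * 2 : ℝ) : ℂ) *
              (f y * (((⟪y, e i⟫_ℝ : ℝ) : ℂ) * fderiv ℝ g y (e i))
              - g y * (((⟪y, e i⟫_ℝ : ℝ) : ℂ) * fderiv ℝ f y (e i))) := by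
        intro i
        have hfi := ((contDiffOn_fderiv_apply hf (e i)).contDiffAt hmem).differentiableAt (by simp)
        have hgi := ((contDiffOn_fderiv_apply hg (e i)).contDiffAt hmem).differentiableAt (by simp)
        have h := hη.mul ((hfd.hasFDerivAt.mul hgi.hasFDerivAt).sub
          (hgd.hasFDerivAt.mul hfi.hasFDerivAt))
        have h' : HasFDerivAt (fun y => (radialCutoff y : ℂ) * W i y) _ y := h
        rw [h'.fderiv]
        simp only [add_apply, smul_apply, sub_apply, smul_eq_mul,
          ContinuousLinearMap.comp_apply, Complex.ofRealCLM_apply, fderiv_radialCutoff,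
          Pi.sub_apply, Pi.mul_apply]
        push_cast
        ring
      rw [Finset.sum_congr rfl fun i _ => hterm i, Finset.sum_add_distrib, ← Finset.mul_sum,
        ← Finset.mul_sum, Finset.sum_sub_distrib, Finset.sum_sub_distrib, ← Finset.mul_sum,
        ← Finset.mul_sum, ← Finset.mul_sum, ← Finset.mul_sum, sum_basisFun_mul_fderiv,
        sum_basisFun_mul_fderiv, hf0.fderiv_self hfd, hg0.fderiv_self hgd,
        laplacian_eq_sum_fderiv (hf.contDiffAt hmem), laplacian_eq_sum_fderiv (hg.contDiffAt hmem)]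
      rw [mul_zero, mul_zero, sub_zero, mul_zero, add_zero]
  simp_rw [hsum]
  rw [integral_finsetSum _ fun i _ => ?_]
  · exact Finset.sum_eq_zero fun i _ =>
      integral_fderiv_apply_eq_zero ((hH i).of_le (by exact_mod_cast le_top)) (hHc i) _
  · exact (((hH i).continuous_fderiv (by simp)).clm_apply
      continuous_const).integrable_of_hasCompactSupport ((hHc i).fderiv_apply (𝕜 := ℝ) _)

instance instIsFiniteMeasureSurfaceMeasure (n : ℕ) : IsFiniteMeasure (surfaceMeasure n) :=
  inferInstanceAs (IsFiniteMeasure (volume : Measure (Euc n)).toSphere)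

theorem nontrivial_euc (n : ℕ) [NeZero n] : Nontrivial (Euc n) :=
  Module.nontrivial_of_finrank_pos (R := ℝ) (by
    rw [finrank_euclideanSpace_fin]; exact Nat.pos_of_ne_zero (NeZero.ne n))

/-- Polar coordinates for the product of a radial function and a function of the direction. -/
theorem integral_radial_mul_angular {n : ℕ} [NeZero n] (φ : ℝ → ℂ) (Q : Sph n → ℂ) (K : Euc n → ℂ)
    (hK : ∀ (u : Sph n) (r : ℝ), 0 < r → K (r • (u : Euc n)) = φ r * Q u) :
    ∫ y, K y = (∫ u, Q u ∂(surfaceMeasure n)) *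
      ∫ r : Ioi (0 : ℝ), φ r ∂(Measure.volumeIoiPow (n - 1)) := by
  have := nontrivial_euc n
  have hmp := (volume : Measure (Euc n)).measurePreserving_homeomorphUnitSphereProd
  rw [finrank_euclideanSpace_fin] at hmp
  have h1 := hmp.integral_comp (Homeomorph.measurableEmbedding _)
    (fun p : Sph n × Ioi (0 : ℝ) => Q p.1 * φ p.2)
  rw [integral_prod_mul (f := Q) (g := fun r : Ioi (0 : ℝ) => φ r)] at h1
  have h2 := integral_subtype_comap (μ := volume) (measurableSet_singleton (0 : Euc n)).compl K
  rw [restrict_compl_singleton] at h2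
  rw [surfaceMeasure, ← h1, ← h2]
  refine integral_congr_ae (Filter.Eventually.of_forall ?_)
  intro (y : ({0}ᶜ : Set (Euc n)))
  have hy : 0 < ‖(y : Euc n)‖ := norm_pos_iff.2 (show (y : Euc n) ≠ 0 from y.2)
  have := hK (homeomorphUnitSphereProd (Euc n) y).1 (homeomorphUnitSphereProd (Euc n) y).2
    (homeomorphUnitSphereProd (Euc n) y).2.2
  simp only
  rw [mul_comm, ← this]
  congr 1
  simp [smul_smul, mul_inv_cancel₀ hy.ne']

theorem radialCutoff_smul {n : ℕ} (u : Sph n) (r : ℝ) :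
    radialCutoff (r • (u : Euc n)) = radialBump (r ^ 2) := by
  have hu : ‖(u : Euc n)‖ = 1 := norm_eq_of_mem_sphere u
  rw [radialCutoff, norm_smul, hu, mul_one, Real.norm_eq_abs, sq_abs]

theorem integral_radialBump_ne_zero (n : ℕ) [NeZero n] :
    ∫ r : Ioi (0 : ℝ), ((radialBump (r ^ 2 : ℝ) * (r ^ 2 : ℝ)⁻¹ : ℝ) : ℂ)
      ∂(Measure.volumeIoiPow (n - 1)) ≠ 0 := by
  have := nontrivial_euc n
  -- By polar coordinates the integral is a factor of a positive integral over `ℝⁿ`.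
  have hpol := integral_radial_mul_angular (n := n)
    (fun r => ((radialBump (r ^ 2) * (r ^ 2)⁻¹ : ℝ) : ℂ)) (fun _ => 1)
    (fun y => ((radialCutoff y * (‖y‖ ^ 2)⁻¹ : ℝ) : ℂ)) (fun u r hr => by
      have hu : ‖(u : Euc n)‖ = 1 := norm_eq_of_mem_sphere u
      rw [radialCutoff_smul, norm_smul, hu, mul_one, mul_one, Real.norm_eq_abs, sq_abs])
  intro h0
  rw [h0, mul_zero, integral_complex_ofReal, Complex.ofReal_eq_zero] at hpol
  have hcs : HasCompactSupport fun y : Euc n => radialCutoff y * (‖y‖ ^ 2)⁻¹ :=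
    hasCompactSupport_radialCutoff.mul_right
  have hcont : Continuous fun y : Euc n => radialCutoff y * (‖y‖ ^ 2)⁻¹ := by
    have hs : ContDiffOn ℝ ∞ (fun y : Euc n => ((‖y‖ ^ 2)⁻¹ : ℂ)) {0}ᶜ := by
      intro y hy
      have h := ((contDiff_norm_sq ℝ (n := ∞) (E := Euc n)).contDiffAt (x := y)).inv
        (by simpa using hy)
      have h2 := (Complex.ofRealCLM.contDiff.contDiffAt).comp y h
      simpa [Function.comp_def] using h2.contDiffWithinAt
    have := Complex.continuous_re.comp (contDiff_radialCutoff_mul hs).continuous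
    refine this.congr fun y => ?_
    simp only [Function.comp]
    rw [← Complex.ofReal_re (radialCutoff y * (‖y‖ ^ 2)⁻¹)]
    push_cast
    rfl
  obtain ⟨v, hv⟩ := exists_norm_eq (Euc n) zero_le_one
  have hpos := hcont.integral_pos_of_hasCompactSupport_nonneg_nonzero (x := v)
    (μ := (volume : Measure (Euc n))) hcs
    (fun y => mul_nonneg radialBump.nonneg (by positivity)) (by
      have : radialCutoff v = 1 := by
        rw [radialCutoff, hv, one_pow]
        exact radialBump.one_of_mem_closedBall (Metric.mem_closedBall_self radialBump.rIn_pos.le)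
      rw [this, hv]; norm_num)
  exact hpos.ne' hpol

theorem isRadiallyConst_radialExt {n : ℕ} (F : Sph n → ℂ) : IsRadiallyConst (radialExt F) := by
  intro c y hc
  by_cases hy : y = 0
  · simp [hy]
  · have hcy : c • y ≠ 0 := smul_ne_zero hc.ne' hy
    rw [radialExt, radialExt, dif_pos hcy, dif_pos hy]
    congr 2
    rw [norm_smul, smul_smul, Real.norm_of_nonneg hc.le, mul_inv, mul_assoc, mul_comm _ c,
      ← mul_assoc, inv_mul_cancel₀ hc.ne', one_mul]

theorem coe_sphere_ne_zero {n : ℕ} (u : Sph n) : (u : Euc n) ≠ 0 := by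
  have hu : ‖(u : Euc n)‖ = 1 := norm_eq_of_mem_sphere u
  intro h
  rw [h, norm_zero] at hu
  exact zero_ne_one hu

theorem continuous_of_contDiffOn_radialExt {n : ℕ} {F : Sph n → ℂ}
    (hF : ContDiffOn ℝ ∞ (radialExt F) {0}ᶜ) : Continuous F := by
  have : Continuous fun u : Sph n => radialExt F (u : Euc n) :=
    hF.continuousOn.comp_continuous continuous_subtype_val fun u => coe_sphere_ne_zero u
  exact this.congr fun u => radialExt_coe F u

theorem continuous_sphLaplacian {n : ℕ} {F : Sph n → ℂ}
    (hF : ContDiffOn ℝ ∞ (radialExt F) {0}ᶜ) : Continuous (sphLaplacian F) :=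
  (contDiffOn_laplacian hF).continuousOn.comp_continuous continuous_subtype_val
    fun u => coe_sphere_ne_zero u

theorem integrable_surfaceMeasure {n : ℕ} {F : Sph n → ℂ} (hF : Continuous F) :
    Integrable F (surfaceMeasure n) :=
  integrableOn_univ.1 (hF.continuousOn.integrableOn_compact isCompact_univ)

/-- The Laplace-Beltrami operator of the sphere is symmetric: in polar coordinates Green's formula
in `ℝⁿ` is the asserted identity times a nonzero radial integral. -/
theorem integral_mul_sphLaplacian {n : ℕ} [NeZero n] {F G : Sph n → ℂ}
    (hF : ContDiffOn ℝ ∞ (radialExt F) {0}ᶜ) (hG : ContDiffOn ℝ ∞ (radialExt G) {0}ᶜ) :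
    ∫ u, F u * sphLaplacian G u ∂(surfaceMeasure n)
      = ∫ u, G u * sphLaplacian F u ∂(surfaceMeasure n) := by
  have hgreen := integral_radialCutoff_mul_green hF hG (isRadiallyConst_radialExt F)
    (isRadiallyConst_radialExt G)
  rw [integral_radial_mul_angular (fun r => ((radialBump (r ^ 2) * (r ^ 2)⁻¹ : ℝ) : ℂ))
    (fun u => F u * sphLaplacian G u - G u * sphLaplacian F u) _ (fun u r hr => by
      have hr0 : (r : ℂ) ≠ 0 := by exact_mod_cast hr.ne'
      have h1 := (isRadiallyConst_radialExt G).laplacian_smul hr (u : Euc n)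
      have h2 := (isRadiallyConst_radialExt F).laplacian_smul hr (u : Euc n)
      rw [radialCutoff_smul, isRadiallyConst_radialExt F r u hr, isRadiallyConst_radialExt G r u hr,
        radialExt_coe, radialExt_coe, sphLaplacian, sphLaplacian, ← h1, ← h2]
      push_cast
      field_simp)] at hgreen
  have h0 := (mul_eq_zero.1 hgreen).resolve_right (integral_radialBump_ne_zero n)
  rw [integral_sub] at h0
  · exact sub_eq_zero.1 h0
  · exact integrable_surfaceMeasure
      ((continuous_of_contDiffOn_radialExt hF).mul (continuous_sphLaplacian hG))
  · exact integrable_surfaceMeasure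
      ((continuous_of_contDiffOn_radialExt hG).mul (continuous_sphLaplacian hF))

/-! ### The Laplace-Beltrami operator of a ridge function -/

theorem hasFDerivAt_inv_norm {n : ℕ} {y : Euc n} (hy : y ≠ 0) :
    HasFDerivAt (fun z : Euc n => ‖z‖⁻¹) (-(‖y‖⁻¹ ^ 3) • innerSL ℝ y) y := by
  have hn : ‖y‖ ≠ 0 := norm_ne_zero_iff.2 hy
  have h0 := (hasStrictFDerivAt_norm_sq y).hasFDerivAt.sqrt (by positivity)
  simp only [Real.sqrt_sq (norm_nonneg _)] at h0
  refine ((hasDerivAt_inv hn).comp_hasFDerivAt y h0).congr_fderiv ?_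
  ext v
  simp only [smul_apply, smul_eq_mul, nsmul_eq_mul, innerSL_apply_apply]
  push_cast
  field_simp

/-- The ridge function `u ↦ w (x · u)` on the sphere. -/
def sphRidge {n : ℕ} (w : ℝ → ℂ) (x : Euc n) (u : Sph n) : ℂ := w ⟪x, (u : Euc n)⟫_ℝ

theorem radialExt_sphRidge {n : ℕ} (w : ℝ → ℂ) (x : Euc n) {y : Euc n} (hy : y ≠ 0) :
    radialExt (sphRidge w x) y = w (⟪x, y⟫_ℝ * ‖y‖⁻¹) := by
  rw [radialExt, dif_pos hy, sphRidge, real_inner_smul_right, mul_comm]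

theorem hasFDerivAt_inner_mul_inv_norm {n : ℕ} (x : Euc n) {y : Euc n} (hy : y ≠ 0) :
    HasFDerivAt (fun z : Euc n => ⟪x, z⟫_ℝ * ‖z‖⁻¹)
      (⟪x, y⟫_ℝ • (-(‖y‖⁻¹ ^ 3) • innerSL ℝ y) + ‖y‖⁻¹ • innerSL ℝ x) y :=
  (innerSL ℝ x).hasFDerivAt.mul (hasFDerivAt_inv_norm hy)

theorem contDiffOn_radialExt_sphRidge {n : ℕ} {w : ℝ → ℂ} (hw : ContDiff ℝ ∞ w) (x : Euc n) :
    ContDiffOn ℝ ∞ (radialExt (sphRidge w x)) {0}ᶜ := by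
  have h : ContDiffOn ℝ ∞ (fun y : Euc n => w (⟪x, y⟫_ℝ * ‖y‖⁻¹)) {0}ᶜ := by
    intro y hy
    have hy' : y ≠ 0 := hy
    have h1 : ContDiffAt ℝ ∞ (fun y : Euc n => ⟪x, y⟫_ℝ * ‖y‖⁻¹) y :=
      (innerSL ℝ x).contDiff.contDiffAt.mul
        ((contDiffAt_norm ℝ hy').inv (norm_ne_zero_iff.2 hy'))
    exact (hw.contDiffAt.comp y h1).contDiffWithinAt
  exact h.congr fun y hy => radialExt_sphRidge w x hy

theorem fderiv_radialExt_sphRidge {n : ℕ} {w w' : ℝ → ℂ} (hw : ∀ t, HasDerivAt w (w' t) t)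
    (x : Euc n) {y : Euc n} (hy : y ≠ 0) (v : Euc n) :
    fderiv ℝ (radialExt (sphRidge w x)) y v
      = ((⟪x, v⟫_ℝ * ‖y‖⁻¹ - ⟪x, y⟫_ℝ * ⟪y, v⟫_ℝ * ‖y‖⁻¹ ^ 3 : ℝ) : ℂ)
        * w' (⟪x, y⟫_ℝ * ‖y‖⁻¹) := by
  have h := (hw (⟪x, y⟫_ℝ * ‖y‖⁻¹)).hasFDerivAt.comp y (hasFDerivAt_inner_mul_inv_norm x hy)
  have e : radialExt (sphRidge w x) =ᶠ[nhds y] w ∘ fun z : Euc n => ⟪x, z⟫_ℝ * ‖z‖⁻¹ := by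
    filter_upwards [isOpen_compl_singleton.mem_nhds hy] with z hz using radialExt_sphRidge w x hz
  rw [(h.congr_of_eventuallyEq e).fderiv]
  simp only [add_apply, smul_apply, ContinuousLinearMap.toSpanSingleton_apply, ContinuousLinearMap.comp_apply,
    smul_eq_mul, innerSL_apply_apply, Complex.real_smul]
  push_cast
  ring

theorem fderiv_fderiv_radialExt_sphRidge {n : ℕ} {w w' w'' : ℝ → ℂ}
    (hw : ∀ t, HasDerivAt w (w' t) t) (hw' : ∀ t, HasDerivAt w' (w'' t) t)
    (x : Euc n) {y : Euc n} (hu : ‖y‖ = 1) {v : Euc n} (hv : ‖v‖ = 1) :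
    fderiv ℝ (fun y => fderiv ℝ (radialExt (sphRidge w x)) y v) y v
      = ((⟪x, v⟫_ℝ - ⟪x, y⟫_ℝ * ⟪y, v⟫_ℝ : ℝ) : ℂ) ^ 2 *
          w'' ⟪x, y⟫_ℝ
        + ((3 * ⟪x, y⟫_ℝ * ⟪y, v⟫_ℝ ^ 2 - 2 * (⟪x, v⟫_ℝ * ⟪y, v⟫_ℝ)
          - ⟪x, y⟫_ℝ : ℝ) : ℂ) * w' ⟪x, y⟫_ℝ := by
  have hy0 : y ≠ 0 := norm_ne_zero_iff.1 (hu ▸ one_ne_zero)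
  have hin := hasFDerivAt_inv_norm hy0
  have hq := hasFDerivAt_inner_mul_inv_norm x hy0
  have hA : HasFDerivAt (fun y : Euc n => ⟪x, v⟫_ℝ * ‖y‖⁻¹ - ⟪x, y⟫_ℝ * ⟪y, v⟫_ℝ * ‖y‖⁻¹ ^ 3)
      _ y := (hin.const_mul ⟪x, v⟫_ℝ).sub
        (((innerSL ℝ x).hasFDerivAt.mul ((innerSL ℝ).flip v).hasFDerivAt).mul (hin.pow 3))
  have h := (Complex.ofRealCLM.hasFDerivAt.comp y hA).mul
    ((hw' (⟪x, y⟫_ℝ * ‖y‖⁻¹)).hasFDerivAt.comp y hq)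
  have e : (fun y => fderiv ℝ (radialExt (sphRidge w x)) y v) =ᶠ[nhds y]
      fun y => ((⟪x, v⟫_ℝ * ‖y‖⁻¹ - ⟪x, y⟫_ℝ * ⟪y, v⟫_ℝ * ‖y‖⁻¹ ^ 3 : ℝ) : ℂ)
        * w' (⟪x, y⟫_ℝ * ‖y‖⁻¹) := by
    filter_upwards [isOpen_compl_singleton.mem_nhds hy0] with z hz using
      fderiv_radialExt_sphRidge hw x hz v
  rw [e.fderiv_eq]
  have h' : HasFDerivAt (fun y => ((⟪x, v⟫_ℝ * ‖y‖⁻¹ - ⟪x, y⟫_ℝ * ⟪y, v⟫_ℝ * ‖y‖⁻¹ ^ 3 : ℝ) : ℂ)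
        * w' (⟪x, y⟫_ℝ * ‖y‖⁻¹)) _ y := h
  rw [h'.fderiv]
  have hvv : ⟪v, v⟫_ℝ = 1 := by rw [real_inner_self_eq_norm_sq, hv, one_pow]
  simp only [add_apply, sub_apply, smul_apply, Pi.mul_apply,
    ContinuousLinearMap.toSpanSingleton_apply, ContinuousLinearMap.comp_apply,
    ContinuousLinearMap.flip_apply, nsmul_eq_mul, Function.comp,
    smul_eq_mul, innerSL_apply_apply, Complex.real_smul, Complex.ofRealCLM_apply, hu, inv_one,
    one_pow, mul_one, hvv]
  push_cast
  ring

/-- On a ridge function, the Laplace-Beltrami operator is an ordinary differential operator in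
`t = x · u`, in which `|x|²` appears as a factor of the second derivative. -/
theorem sphLaplacian_sphRidge {n : ℕ} {w w' w'' : ℝ → ℂ} (hws : ContDiff ℝ ∞ w)
    (hw : ∀ t, HasDerivAt w (w' t) t) (hw' : ∀ t, HasDerivAt w' (w'' t) t) (x : Euc n) (u : Sph n) :
    sphLaplacian (sphRidge w x) u
      = ((‖x‖ ^ 2 - ⟪x, (u : Euc n)⟫_ℝ ^ 2 : ℝ) : ℂ) * w'' ⟪x, (u : Euc n)⟫_ℝ
        - (((n - 1) * ⟪x, (u : Euc n)⟫_ℝ : ℝ) : ℂ) * w' ⟪x, (u : Euc n)⟫_ℝ := by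
  have hu : ‖(u : Euc n)‖ = 1 := norm_eq_of_mem_sphere u
  set e := EuclideanSpace.basisFun (Fin n) ℝ with he
  rw [sphLaplacian, laplacian_eq_sum_fderiv ((contDiffOn_radialExt_sphRidge hws x).contDiffAt
    (isOpen_compl_singleton.mem_nhds (coe_sphere_ne_zero u)))]
  rw [Finset.sum_congr rfl fun i _ =>
    fderiv_fderiv_radialExt_sphRidge hw hw' x hu (e.orthonormal.1 i)]
  rw [Finset.sum_add_distrib, ← Finset.sum_mul, ← Finset.sum_mul]
  have sxx : ∑ i, ⟪x, e i⟫_ℝ ^ 2 = ‖x‖ ^ 2 := by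
    rw [← real_inner_self_eq_norm_sq, ← e.sum_inner_mul_inner x x]
    exact Finset.sum_congr rfl fun i _ => by rw [real_inner_comm x (e i), sq]
  have suu : ∑ i, ⟪(u : Euc n), e i⟫_ℝ ^ 2 = 1 := by
    have : ⟪(u : Euc n), (u : Euc n)⟫_ℝ = 1 := by rw [real_inner_self_eq_norm_sq, hu, one_pow]
    refine Eq.trans ?_ ((e.sum_inner_mul_inner (u : Euc n) u).trans this)
    exact Finset.sum_congr rfl fun i _ => by rw [real_inner_comm (u : Euc n) (e i), sq]
  have sxu : ∑ i, ⟪x, e i⟫_ℝ * ⟪(u : Euc n), e i⟫_ℝ = ⟪x, (u : Euc n)⟫_ℝ := by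
    rw [← e.sum_inner_mul_inner x u]
    exact Finset.sum_congr rfl fun i _ => by rw [real_inner_comm (u : Euc n) (e i)]
  have s1 : ∑ i, (⟪x, e i⟫_ℝ - ⟪x, (u : Euc n)⟫_ℝ * ⟪(u : Euc n), e i⟫_ℝ) ^ 2
      = ‖x‖ ^ 2 - ⟪x, (u : Euc n)⟫_ℝ ^ 2 := by
    have : ∀ i, (⟪x, e i⟫_ℝ - ⟪x, (u : Euc n)⟫_ℝ * ⟪(u : Euc n), e i⟫_ℝ) ^ 2
        = ⟪x, e i⟫_ℝ ^ 2 - 2 * ⟪x, (u : Euc n)⟫_ℝ * (⟪x, e i⟫_ℝ * ⟪(u : Euc n), e i⟫_ℝ)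
          + ⟪x, (u : Euc n)⟫_ℝ ^ 2 * ⟪(u : Euc n), e i⟫_ℝ ^ 2 := fun i => by ring
    rw [Finset.sum_congr rfl fun i _ => this i, Finset.sum_add_distrib, Finset.sum_sub_distrib,
      ← Finset.mul_sum, ← Finset.mul_sum, sxx, suu, sxu]
    ring
  have s2 : ∑ i, (3 * ⟪x, (u : Euc n)⟫_ℝ * ⟪(u : Euc n), e i⟫_ℝ ^ 2
      - 2 * (⟪x, e i⟫_ℝ * ⟪(u : Euc n), e i⟫_ℝ) - ⟪x, (u : Euc n)⟫_ℝ)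
      = -((n - 1) * ⟪x, (u : Euc n)⟫_ℝ) := by
    rw [Finset.sum_sub_distrib, Finset.sum_sub_distrib, ← Finset.mul_sum, ← Finset.mul_sum, suu,
      sxu, Finset.sum_const, Finset.card_univ, Fintype.card_fin, nsmul_eq_mul]
    ring
  have s1' := congrArg (fun r : ℝ => (r : ℂ)) s1
  have s2' := congrArg (fun r : ℝ => (r : ℂ)) s2
  simp only [Complex.ofReal_sum, Complex.ofReal_pow] at s1'
  simp only [Complex.ofReal_sum] at s2'
  rw [s1', s2']
  push_cast
  ring

/-- Multiplication of a spherical superposition of ridge functions by `|x|²`. -/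
theorem norm_sq_mul_integral_ridge {n : ℕ} [NeZero n] {F : Sph n → ℂ}
    (hF : ContDiffOn ℝ ∞ (radialExt F) {0}ᶜ) {w w' w'' : ℝ → ℂ} (hws : ContDiff ℝ ∞ w)
    (hw : ∀ t, HasDerivAt w (w' t) t) (hw' : ∀ t, HasDerivAt w' (w'' t) t) (x : Euc n) :
    ((‖x‖ ^ 2 : ℝ) : ℂ) * ∫ u, F u * w'' ⟪x, (u : Euc n)⟫_ℝ ∂(surfaceMeasure n)
      = ∫ u, (sphLaplacian F u * w ⟪x, (u : Euc n)⟫_ℝ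
          + F u * ((⟪x, (u : Euc n)⟫_ℝ : ℂ) ^ 2 * w'' ⟪x, (u : Euc n)⟫_ℝ
            + (n - 1) * (⟪x, (u : Euc n)⟫_ℝ : ℂ) * w' ⟪x, (u : Euc n)⟫_ℝ))
          ∂(surfaceMeasure n) := by
  have hR := contDiffOn_radialExt_sphRidge hws x
  have hsymm := integral_mul_sphLaplacian hF hR
  have hFc := continuous_of_contDiffOn_radialExt hF
  have hin : Continuous fun u : Sph n => ⟪x, (u : Euc n)⟫_ℝ :=
    (innerSL ℝ x).continuous.comp continuous_subtype_val
  have hw1 : deriv w = w' := funext fun t => (hw t).deriv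
  have hw2 : deriv w' = w'' := funext fun t => (hw' t).deriv
  have hws' : ContDiff ℝ ∞ w' := hw1 ▸ (contDiff_infty_iff_deriv.1 hws).2
  have hws'' : ContDiff ℝ ∞ w'' := hw2 ▸ (contDiff_infty_iff_deriv.1 hws').2
  have c0 := hws.continuous.comp hin
  have c1 := hws'.continuous.comp hin
  have c2 := hws''.continuous.comp hin
  have hinc : Continuous fun u : Sph n => (⟪x, (u : Euc n)⟫_ℝ : ℂ) :=
    Complex.continuous_ofReal.comp hin
  have i1 : Integrable (fun u : Sph n => sphLaplacian F u * w ⟪x, (u : Euc n)⟫_ℝ)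
      (surfaceMeasure n) := integrable_surfaceMeasure ((continuous_sphLaplacian hF).mul c0)
  have i2 : Integrable (fun u : Sph n => F u * ((⟪x, (u : Euc n)⟫_ℝ : ℂ) ^ 2 *
      w'' ⟪x, (u : Euc n)⟫_ℝ + (n - 1) * (⟪x, (u : Euc n)⟫_ℝ : ℂ) * w' ⟪x, (u : Euc n)⟫_ℝ))
      (surfaceMeasure n) := integrable_surfaceMeasure
        (hFc.mul (((hinc.pow 2).mul c2).add ((continuous_const.mul hinc).mul c1)))
  have e1 : ∫ u, sphLaplacian F u * w ⟪x, (u : Euc n)⟫_ℝ ∂(surfaceMeasure n)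
      = ∫ u, F u * sphLaplacian (sphRidge w x) u ∂(surfaceMeasure n) := by
    rw [hsymm]
    exact integral_congr_ae (Filter.Eventually.of_forall fun u => mul_comm _ _)
  rw [integral_add i1 i2, e1, ← integral_add _ i2, ← integral_const_mul]
  · refine integral_congr_ae (Filter.Eventually.of_forall fun u => ?_)
    simp only
    rw [sphLaplacian_sphRidge hws hw hw']
    push_cast
    ring
  · exact integrable_surfaceMeasure (hFc.mul (continuous_sphLaplacian hR))

/-! ### Superpositions of ridge functions with an integrable weight -/

/-- The measure `du db da` on `𝕊ⁿ⁻¹ × ℝ × (0, ∞)`. -/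
def muY (n : ℕ) : Measure (Sph n × ℝ × ℝ) :=
  (surfaceMeasure n).prod ((volume : Measure ℝ).prod ((volume : Measure ℝ).restrict (Ioi 0)))

theorem ae_muY_pos (n : ℕ) : ∀ᵐ p ∂(muY n), 0 < p.2.2 := by
  have h : ∀ᵐ a ∂((volume : Measure ℝ).restrict (Ioi 0)), 0 < a := ae_restrict_mem measurableSet_Ioi
  have h2 := (Measure.quasiMeasurePreserving_snd (μ := (volume : Measure ℝ))
    (ν := (volume : Measure ℝ).restrict (Ioi 0))).ae h
  exact (Measure.quasiMeasurePreserving_snd (μ := surfaceMeasure n)).ae h2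

/-- The argument `(x · u - b) / a` of a ridgelet. -/
def ridgeArg {n : ℕ} (x : Euc n) (p : Sph n × ℝ × ℝ) : ℝ := (⟪x, (p.1 : Euc n)⟫_ℝ - p.2.1) / p.2.2

/-- The superposition `x ↦ ∫ W(u, b, a) χ((x · u - b) / a) du db da`. -/
def ridgeInt {n : ℕ} (W : Sph n × ℝ × ℝ → ℂ) (χ : ℝ → ℂ) (x : Euc n) : ℂ :=
  ∫ p, W p * χ (ridgeArg x p) ∂(muY n)

/-- `W` is integrable against all the powers `a⁻ᵏ`, which are the factors that appear when
a ridgelet is differentiated. -/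
def IsRidgeWeight {n : ℕ} (W : Sph n × ℝ × ℝ → ℂ) : Prop :=
  ∀ k : ℕ, Integrable (fun p => W p * ((p.2.2⁻¹ ^ k : ℝ) : ℂ)) (muY n)

theorem measurable_ridgeArg {n : ℕ} (x : Euc n) : Measurable (ridgeArg x) := by
  have h : Continuous fun p : Sph n × ℝ × ℝ => ⟪x, (p.1 : Euc n)⟫_ℝ - p.2.1 := by fun_prop
  exact h.measurable.div (measurable_snd.comp measurable_snd)

theorem IsRidgeWeight.integrable {n : ℕ} {W : Sph n × ℝ × ℝ → ℂ} (hW : IsRidgeWeight W) :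
    Integrable W (muY n) := by
  simpa using hW 0

theorem IsRidgeWeight.integrable_mul {n : ℕ} {W : Sph n × ℝ × ℝ → ℂ} (hW : IsRidgeWeight W)
    (χ : 𝓢(ℝ, ℂ)) (x : Euc n) : Integrable (fun p => W p * χ (ridgeArg x p)) (muY n) :=
  hW.integrable.mul_bdd (c := SchwartzMap.seminorm ℂ 0 0 χ)
    (χ.continuous.measurable.comp (measurable_ridgeArg x)).aestronglyMeasurable
    (Filter.Eventually.of_forall fun _ => SchwartzMap.norm_le_seminorm ℂ χ _)

/-- The weight that appears in the derivative in the direction `v`. -/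
def derivWeight {n : ℕ} (v : Euc n) (W : Sph n × ℝ × ℝ → ℂ) (p : Sph n × ℝ × ℝ) : ℂ :=
  W p * ((p.2.2⁻¹ * ⟪(p.1 : Euc n), v⟫_ℝ : ℝ) : ℂ)

theorem norm_derivWeight_mul_le {n : ℕ} (v : Euc n) (W : Sph n × ℝ × ℝ → ℂ) (k : ℕ)
    (p : Sph n × ℝ × ℝ) : ‖derivWeight v W p * ((p.2.2⁻¹ ^ k : ℝ) : ℂ)‖
      ≤ ‖v‖ * ‖W p * ((p.2.2⁻¹ ^ (k + 1) : ℝ) : ℂ)‖ := by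
  have hu : ‖(p.1 : Euc n)‖ = 1 := norm_eq_of_mem_sphere p.1
  have h := norm_inner_le_norm (𝕜 := ℝ) (p.1 : Euc n) v
  rw [hu, one_mul] at h
  simp only [derivWeight, norm_mul, Complex.norm_real, norm_pow, pow_succ]
  calc ‖W p‖ * (‖p.2.2⁻¹‖ * ‖⟪(p.1 : Euc n), v⟫_ℝ‖) * ‖p.2.2⁻¹‖ ^ k
      ≤ ‖W p‖ * (‖p.2.2⁻¹‖ * ‖v‖) * ‖p.2.2⁻¹‖ ^ k := by gcongr
    _ = _ := by ring

theorem IsRidgeWeight.derivWeight {n : ℕ} {W : Sph n × ℝ × ℝ → ℂ} (hW : IsRidgeWeight W)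
    (v : Euc n) : IsRidgeWeight (derivWeight v W) := by
  intro k
  refine ((hW (k + 1)).norm.const_mul ‖v‖).mono' ?_
    (Filter.Eventually.of_forall fun p => norm_derivWeight_mul_le v W k p)
  have h1 : Measurable fun p : Sph n × ℝ × ℝ => p.2.2⁻¹ :=
    (measurable_snd.comp measurable_snd).inv
  have h2 : Continuous fun p : Sph n × ℝ × ℝ => ⟪(p.1 : Euc n), v⟫_ℝ := by fun_prop
  exact (hW.integrable.aestronglyMeasurable.mul
    (Complex.measurable_ofReal.comp (h1.mul h2.measurable)).aestronglyMeasurable).mul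
    (Complex.measurable_ofReal.comp (h1.pow_const k)).aestronglyMeasurable

theorem hasFDerivAt_ridgeArg {n : ℕ} (x : Euc n) (p : Sph n × ℝ × ℝ) :
    HasFDerivAt (fun x => ridgeArg x p) (p.2.2⁻¹ • innerSL ℝ (p.1 : Euc n)) x := by
  have e : (fun x => ridgeArg x p)
      = fun x => p.2.2⁻¹ * (innerSL ℝ (p.1 : Euc n) x - p.2.1) := by
    funext x
    rw [ridgeArg, innerSL_apply_apply, real_inner_comm, div_eq_inv_mul]
  rw [e]
  exact ((innerSL ℝ (p.1 : Euc n)).hasFDerivAt.sub_const p.2.1).const_mul p.2.2⁻¹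

theorem hasFDerivAt_ridgeInt {n : ℕ} {W : Sph n × ℝ × ℝ → ℂ} (hW : IsRidgeWeight W)
    (χ : 𝓢(ℝ, ℂ)) (x : Euc n) :
    ∃ D : Euc n →L[ℝ] ℂ, HasFDerivAt (ridgeInt W χ) D x ∧
      ∀ v, D v = ridgeInt (derivWeight v W) (SchwartzMap.derivCLM ℂ ℂ χ) x := by
  set χ' := SchwartzMap.derivCLM ℂ ℂ χ with hχ'
  set F' : Euc n → Sph n × ℝ × ℝ → (Euc n →L[ℝ] ℂ) := fun x p =>
    (W p * χ' (ridgeArg x p)) • Complex.ofRealCLM.comp (p.2.2⁻¹ • innerSL ℝ (p.1 : Euc n)) with hF'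
  have hmeas : AEStronglyMeasurable (F' x) (muY n) := by
    refine (hW.integrable.aestronglyMeasurable.mul
      (χ'.continuous.measurable.comp (measurable_ridgeArg x)).aestronglyMeasurable).smul ?_
    have h1 : Measurable fun p : Sph n × ℝ × ℝ => p.2.2⁻¹ :=
      (measurable_snd.comp measurable_snd).inv
    have h2 : Continuous fun p : Sph n × ℝ × ℝ => innerSL ℝ (p.1 : Euc n) :=
      (innerSL ℝ).continuous.comp (continuous_subtype_val.comp continuous_fst)
    have h3 : AEStronglyMeasurable (fun p : Sph n × ℝ × ℝ => p.2.2⁻¹ • innerSL ℝ (p.1 : Euc n))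
      (muY n) := h1.aestronglyMeasurable.smul h2.aestronglyMeasurable
    exact ((ContinuousLinearMap.compL ℝ (Euc n) ℝ ℂ
      Complex.ofRealCLM).continuous).comp_aestronglyMeasurable h3
  have hbd : ∀ y p, ‖F' y p‖ ≤ SchwartzMap.seminorm ℂ 0 0 χ' *
      ‖W p * ((p.2.2⁻¹ ^ 1 : ℝ) : ℂ)‖ := by
    intro y p
    refine ContinuousLinearMap.opNorm_le_bound _ (by positivity) fun v => ?_
    have hu : ‖(p.1 : Euc n)‖ = 1 := norm_eq_of_mem_sphere p.1
    have h := norm_inner_le_norm (𝕜 := ℝ) (p.1 : Euc n) v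
    rw [hu, one_mul] at h
    have hs := SchwartzMap.norm_le_seminorm ℂ χ' (ridgeArg y p)
    simp only [hF', smul_apply, ContinuousLinearMap.comp_apply, innerSL_apply_apply,
      Complex.ofRealCLM_apply, smul_eq_mul, norm_mul, Complex.norm_real, pow_one]
    calc ‖W p‖ * ‖χ' (ridgeArg y p)‖ * (‖p.2.2⁻¹‖ * ‖⟪(p.1 : Euc n), v⟫_ℝ‖)
        ≤ ‖W p‖ * SchwartzMap.seminorm ℂ 0 0 χ' * (‖p.2.2⁻¹‖ * ‖v‖) := by gcongr
      _ = _ := by ring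
  have hbi : Integrable (fun p => SchwartzMap.seminorm ℂ 0 0 χ' *
      ‖W p * ((p.2.2⁻¹ ^ 1 : ℝ) : ℂ)‖) (muY n) := (hW 1).norm.const_mul _
  have hFi : Integrable (F' x) (muY n) :=
    hbi.mono' hmeas (Filter.Eventually.of_forall fun p => hbd x p)
  refine ⟨∫ p, F' x p ∂(muY n), ?_, fun v => ?_⟩
  · refine hasFDerivAt_integral_of_dominated_of_fderiv_le
      (F := fun x p => W p * χ (ridgeArg x p)) (s := univ) Filter.univ_mem
      (Filter.Eventually.of_forall fun y => (hW.integrable_mul χ y).aestronglyMeasurable)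
      (hW.integrable_mul χ x) hmeas (Filter.Eventually.of_forall fun p y _ => hbd y p) hbi
      (Filter.Eventually.of_forall fun p y _ => ?_)
    have h := ((χ.hasDerivAt (ridgeArg y p)).hasFDerivAt.comp y
      (hasFDerivAt_ridgeArg y p)).const_mul (W p)
    refine h.congr_fderiv ?_
    ext v
    simp only [hF', hχ', smul_apply, ContinuousLinearMap.comp_apply, innerSL_apply_apply,
      Complex.ofRealCLM_apply, smul_eq_mul, ContinuousLinearMap.toSpanSingleton_apply,
      Complex.real_smul, SchwartzMap.derivCLM_apply]
    push_cast
    ring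
  · rw [ContinuousLinearMap.integral_apply hFi]
    refine integral_congr_ae (Filter.Eventually.of_forall fun p => ?_)
    simp only [hF', derivWeight, smul_apply, ContinuousLinearMap.comp_apply, innerSL_apply_apply,
      Complex.ofRealCLM_apply, smul_eq_mul]
    push_cast
    ring

theorem fderiv_ridgeInt {n : ℕ} {W : Sph n × ℝ × ℝ → ℂ} (hW : IsRidgeWeight W)
    (χ : 𝓢(ℝ, ℂ)) (v : Euc n) : (fun x => fderiv ℝ (ridgeInt W χ) x v)
      = ridgeInt (derivWeight v W) (SchwartzMap.derivCLM ℂ ℂ χ) := by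
  funext x
  obtain ⟨D, hD, hDv⟩ := hasFDerivAt_ridgeInt hW χ x
  rw [hD.fderiv, hDv]

theorem contDiff_ridgeInt {n : ℕ} {W : Sph n × ℝ × ℝ → ℂ} (hW : IsRidgeWeight W)
    (χ : 𝓢(ℝ, ℂ)) : ContDiff ℝ ∞ (ridgeInt W χ) := by
  have hdiff : ∀ {W : Sph n × ℝ × ℝ → ℂ}, IsRidgeWeight W → ∀ χ : 𝓢(ℝ, ℂ),
      Differentiable ℝ (ridgeInt W χ) := fun hW χ x => by
    obtain ⟨D, hD, -⟩ := hasFDerivAt_ridgeInt hW χ x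
    exact hD.differentiableAt
  refine contDiff_infty.2 fun m => ?_
  induction m generalizing W χ with
  | zero => exact contDiff_zero.2 (hdiff hW χ).continuous
  | succ m ih =>
    push_cast
    rw [contDiff_succ_iff_fderiv_apply]
    refine ⟨hdiff hW χ, by simp, fun v => ?_⟩
    rw [fderiv_ridgeInt hW χ v]
    exact ih (hW.derivWeight v) _

theorem seminorm_derivCLM_le (χ : 𝓢(ℝ, ℂ)) (m : ℕ) :
    SchwartzMap.seminorm ℂ 0 m (SchwartzMap.derivCLM ℂ ℂ χ)
      ≤ SchwartzMap.seminorm ℂ 0 (m + 1) χ := by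
  refine SchwartzMap.seminorm_le_bound ℂ 0 m _ (apply_nonneg _ _) fun t => ?_
  refine (le_of_eq ?_).trans (SchwartzMap.le_seminorm ℂ 0 (m + 1) χ t)
  have e : ⇑(SchwartzMap.derivCLM ℂ ℂ χ) = deriv χ := funext fun t => SchwartzMap.derivCLM_apply ℂ χ t
  rw [e, norm_iteratedFDeriv_eq_norm_iteratedDeriv, norm_iteratedFDeriv_eq_norm_iteratedDeriv,
    iteratedDeriv_succ']

/-- Each derivative in a direction `v` replaces `χ` by `χ'` and the weight by `derivWeight v W`,
which costs one factor `a⁻¹`. -/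
theorem norm_iteratedFDeriv_ridgeInt_le {n : ℕ} {W : Sph n × ℝ × ℝ → ℂ} (hW : IsRidgeWeight W)
    (χ : 𝓢(ℝ, ℂ)) (m : ℕ) (x : Euc n) : ‖iteratedFDeriv ℝ m (ridgeInt W χ) x‖
      ≤ (∫ p, ‖W p * ((p.2.2⁻¹ ^ m : ℝ) : ℂ)‖ ∂(muY n)) * SchwartzMap.seminorm ℂ 0 m χ := by
  have hI : ∀ (W : Sph n × ℝ × ℝ → ℂ) m,
      0 ≤ ∫ p, ‖W p * ((p.2.2⁻¹ ^ m : ℝ) : ℂ)‖ ∂(muY n) :=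
    fun W m => integral_nonneg fun p => norm_nonneg _
  refine ContinuousMultilinearMap.opNorm_le_bound (mul_nonneg (hI W m) (apply_nonneg _ _))
    fun v => ?_
  induction m generalizing W χ with
  | zero =>
    simp only [iteratedFDeriv_zero_apply, Finset.univ_eq_empty, Finset.prod_empty, mul_one]
    refine (norm_integral_le_integral_norm _).trans ?_
    rw [← integral_mul_const]
    refine integral_mono (hW.integrable_mul χ x).norm ((hW 0).norm.mul_const _) fun p => ?_
    simp only [pow_zero, Complex.ofReal_one, mul_one, norm_mul]
    exact mul_le_mul_of_nonneg_left (SchwartzMap.norm_le_seminorm ℂ χ _) (norm_nonneg _)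
  | succ m ih =>
    rw [iteratedFDeriv_succ_apply_right, ← iteratedFDeriv_clm_apply_const_apply (n := ∞)
      ((contDiff_ridgeInt hW χ).fderiv_right (m := ∞) (by simp)) (by exact_mod_cast le_top),
      fderiv_ridgeInt hW χ]
    refine (ih (hW.derivWeight _) _ (Fin.init v)).trans ?_
    have h1 : ∫ p, ‖derivWeight (v (Fin.last m)) W p * ((p.2.2⁻¹ ^ m : ℝ) : ℂ)‖ ∂(muY n)
        ≤ ‖v (Fin.last m)‖ * ∫ p, ‖W p * ((p.2.2⁻¹ ^ (m + 1) : ℝ) : ℂ)‖ ∂(muY n) := by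
      rw [← integral_const_mul]
      exact integral_mono ((hW.derivWeight _) m).norm ((hW (m + 1)).norm.const_mul _)
        fun p => norm_derivWeight_mul_le _ W m p
    have h2 := seminorm_derivCLM_le χ m
    have h3 := hI W (m + 1)
    rw [Fin.prod_univ_castSucc]
    calc _ ≤ (‖v (Fin.last m)‖ * ∫ p, ‖W p * ((p.2.2⁻¹ ^ (m + 1) : ℝ) : ℂ)‖ ∂(muY n)) *
          SchwartzMap.seminorm ℂ 0 (m + 1) χ * ∏ i, ‖Fin.init v i‖ := by gcongr
      _ = _ := by simp only [Fin.init]; ring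

/-! ### Weights `Φ(u, b, a) aⁱ bʲ` -/

instance instIsTopologicalAddGroupTestY (n : ℕ) [NeZero n] : IsTopologicalAddGroup (TestY n) :=
  (rho_withSeminorms n).topologicalAddGroup

theorem weight_mul_norm_mixedDeriv_le {n : ℕ} [NeZero n] (Φ : TestY n) (l m k s r : ℕ) (p : Y n) :
    weight s r p * ‖mixedDeriv l m k Φ.toFun p‖ ≤ rho n (l, m, k, s, r) Φ :=
  le_ciSup (Φ.bddAbove l m k s r) p

/-- The Laplace-Beltrami operator as a linear map of `𝓢(𝕐ⁿ⁺¹)`. -/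
def lapLM (n : ℕ) [NeZero n] : TestY n →ₗ[ℂ] TestY n where
  toFun Φ := (⟨lapU Φ.toFun, isGood_lapU.smooth _ Φ.isSmooth,
    fun l m k s r => Φ.2.2 l m (k + 1) s r⟩ : ↥(testSubmodule n))
  map_add' Φ Ψ := Subtype.ext (isGood_lapU.add _ _ Φ.isSmooth Ψ.isSmooth)
  map_smul' c Φ := Subtype.ext (isGood_lapU.smul c _ Φ.isSmooth)

theorem continuous_lapLM (n : ℕ) [NeZero n] : Continuous (lapLM n) := by
  refine (rho_withSeminorms n).continuous_of_continuous_comp _ fun i => ?_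
  obtain ⟨l, m, k, s, r⟩ := i
  exact (rho_withSeminorms n).continuous_seminorm (l, m, k + 1, s, r)

/-- The continuous operator `Δ_u` on `𝓢(𝕐ⁿ⁺¹)`. -/
def lapL (n : ℕ) [NeZero n] : TestY n →L[ℂ] TestY n := ⟨lapLM n, continuous_lapLM n⟩

/-- The weight `Φ(u, b, a) aⁱ bʲ`. -/
def momentWeight {n : ℕ} (i : ℤ) (j : ℕ) (Φ : Y n → ℂ) (p : Sph n × ℝ × ℝ) : ℂ :=
  zeroExt Φ p * ((p.2.2 ^ i * p.2.1 ^ j : ℝ) : ℂ)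

theorem zpow_mul_one_add_sq_le (i : ℤ) {a : ℝ} (ha : 0 < a) :
    a ^ i * (1 + a ^ 2) ≤ 2 * (a ^ (i.natAbs + 2) + 1 / a ^ (i.natAbs + 2)) := by
  have hpos : 0 < a ^ (i.natAbs + 2) := by positivity
  rcases le_total 1 a with h | h
  · have h1 : a ^ i ≤ a ^ i.natAbs := by
      rw [← zpow_natCast]
      exact zpow_le_zpow_right₀ h Int.le_natAbs
    have h2 : 1 + a ^ 2 ≤ 2 * a ^ 2 := by nlinarith
    have h3 : a ^ i * (1 + a ^ 2) ≤ a ^ i.natAbs * (2 * a ^ 2) := by gcongr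
    have h4 : 0 < 1 / a ^ (i.natAbs + 2) := by positivity
    calc _ ≤ _ := h3
      _ = 2 * a ^ (i.natAbs + 2) := by ring
      _ ≤ _ := by linarith
  · have h1 : a ^ i ≤ 1 / a ^ i.natAbs := by
      rw [one_div, ← zpow_natCast, ← zpow_neg]
      exact zpow_le_zpow_right_of_le_one₀ ha h (by omega)
    have h2 : 1 + a ^ 2 ≤ 2 * (1 / a ^ 2) := by
      have : 1 ≤ 1 / a ^ 2 := by
        rw [le_div_iff₀ (by positivity)]; nlinarith
      nlinarith
    have h3 : a ^ i * (1 + a ^ 2) ≤ 1 / a ^ i.natAbs * (2 * (1 / a ^ 2)) := by gcongr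
    calc _ ≤ _ := h3
      _ = 2 * (1 / a ^ (i.natAbs + 2)) := by rw [pow_add]; field_simp
      _ ≤ _ := by linarith

theorem abs_pow_mul_one_add_sq_le (j : ℕ) (b : ℝ) :
    |b| ^ j * (1 + b ^ 2) ≤ (1 + b ^ 2) ^ (((j + 2 : ℕ) : ℝ) / 2) := by
  have h0 : 0 ≤ 1 + b ^ 2 := by positivity
  rw [Real.rpow_div_two_eq_sqrt _ h0, Real.rpow_natCast, pow_add, Real.sq_sqrt h0]
  gcongr
  exact Real.abs_le_sqrt (by linarith)

/-- An integrable function on `𝕊ⁿ⁻¹ × ℝ × ℝ` which dominates all the weights. -/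
def dominant {n : ℕ} (p : Sph n × ℝ × ℝ) : ℝ := 1 * ((1 + p.2.1 ^ 2)⁻¹ * (1 + p.2.2 ^ 2)⁻¹)

theorem integrable_dominant (n : ℕ) : Integrable (dominant (n := n)) (muY n) :=
  (integrable_const (1 : ℝ)).mul_prod
    (integrable_inv_one_add_sq.mul_prod integrable_inv_one_add_sq.integrableOn)

/-- The exponents `|i| + 2` and `j + 2` in the seminorm leave the integrable factor
`(1 + a²)⁻¹ (1 + b²)⁻¹`. -/
theorem norm_momentWeight_le {n : ℕ} [NeZero n] (i : ℤ) (j : ℕ) (Φ : TestY n)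
    {p : Sph n × ℝ × ℝ} (hp : 0 < p.2.2) : ‖momentWeight i j Φ.toFun p‖
      ≤ (2 * rho n (0, 0, 0, i.natAbs + 2, j + 2) Φ) * dominant p := by
  have h := weight_mul_norm_mixedDeriv_le Φ 0 0 0 (i.natAbs + 2) (j + 2) ⟨p, hp⟩
  have e : zeroExt Φ.toFun p = Φ.toFun ⟨p, hp⟩ := zeroExt_coe Φ.toFun ⟨p, hp⟩
  rw [momentWeight, e, norm_mul, Complex.norm_real, norm_mul, norm_pow, norm_zpow,
    Real.norm_of_nonneg hp.le, Real.norm_eq_abs]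
  set N := ‖Φ.toFun ⟨p, hp⟩‖ with hN
  have h' : ((p.2.2 ^ (i.natAbs + 2) + 1 / p.2.2 ^ (i.natAbs + 2)) *
      (1 + p.2.1 ^ 2) ^ (((j + 2 : ℕ) : ℝ) / 2)) * N
      ≤ rho n (0, 0, 0, i.natAbs + 2, j + 2) Φ := h
  have ha := zpow_mul_one_add_sq_le i hp
  have hb := abs_pow_mul_one_add_sq_le j p.2.1
  have hD : dominant p = ((1 + p.2.1 ^ 2) * (1 + p.2.2 ^ 2))⁻¹ := by
    rw [dominant, one_mul, mul_inv]
  rw [hD, ← div_eq_mul_inv, le_div_iff₀ (by positivity)]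
  calc N * (p.2.2 ^ i * |p.2.1| ^ j) * ((1 + p.2.1 ^ 2) * (1 + p.2.2 ^ 2))
      = (p.2.2 ^ i * (1 + p.2.2 ^ 2)) * (|p.2.1| ^ j * (1 + p.2.1 ^ 2)) * N := by ring
    _ ≤ (2 * (p.2.2 ^ (i.natAbs + 2) + 1 / p.2.2 ^ (i.natAbs + 2))) *
        (1 + p.2.1 ^ 2) ^ (((j + 2 : ℕ) : ℝ) / 2) * N := by gcongr
    _ ≤ _ := by linarith

theorem aestronglyMeasurable_zeroExt {n : ℕ} [NeZero n] {Φ : Y n → ℂ} (hΦ : IsSmooth Φ) :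
    AEStronglyMeasurable (zeroExt Φ) (muY n) := by
  have hc : ContinuousOn (zeroExt Φ) (Y n) := by
    have h : ContinuousOn (fun p : Sph n × ℝ × ℝ => flat Φ ((p.1 : Euc n), p.2)) (Y n) :=
      hΦ.contDiffOn_flat.continuousOn.comp
        (Continuous.continuousOn (by fun_prop)) fun p hp => mem_flatDom ⟨p, hp⟩
    exact h.congr fun p _ => (flat_coe Φ p.1 p.2).symm
  have := hc.aestronglyMeasurable (μ := muY n) (Y n).isOpen.measurableSet
  have hae : ∀ᵐ p ∂(muY n), p ∈ (Y n : Set (Sph n × ℝ × ℝ)) := ae_muY_pos n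
  rwa [Measure.restrict_eq_self_of_ae_mem hae] at this

theorem integrable_momentWeight {n : ℕ} [NeZero n] (i : ℤ) (j : ℕ) (Φ : TestY n) :
    Integrable (momentWeight i j Φ.toFun) (muY n) := by
  refine ((integrable_dominant n).const_mul
    (2 * rho n (0, 0, 0, i.natAbs + 2, j + 2) Φ)).mono' ?_ ?_
  · refine (aestronglyMeasurable_zeroExt Φ.isSmooth).mul
      (Complex.measurable_ofReal.comp ?_).aestronglyMeasurable
    exact ((measurable_snd.comp measurable_snd).pow_const i).mul
      ((measurable_fst.comp measurable_snd).pow_const j)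
  · filter_upwards [ae_muY_pos n] with p hp using norm_momentWeight_le i j Φ hp

theorem momentWeight_mul_inv_pow {n : ℕ} (i : ℤ) (j k : ℕ) (Φ : Y n → ℂ) {p : Sph n × ℝ × ℝ}
    (hp : 0 < p.2.2) : momentWeight i j Φ p * ((p.2.2⁻¹ ^ k : ℝ) : ℂ)
      = momentWeight (i - k) j Φ p := by
  rw [momentWeight, momentWeight, mul_assoc, ← Complex.ofReal_mul, zpow_sub₀ hp.ne', zpow_natCast]
  congr 2
  rw [inv_pow]
  ring

theorem isRidgeWeight_momentWeight {n : ℕ} [NeZero n] (i : ℤ) (j : ℕ) (Φ : TestY n) :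
    IsRidgeWeight (momentWeight i j Φ.toFun) := by
  intro k
  refine (integrable_momentWeight (i - k) j Φ).congr ?_
  filter_upwards [ae_muY_pos n] with p hp using (momentWeight_mul_inv_pow i j k _ hp).symm

theorem exists_seminorm_integral_momentWeight_le (n : ℕ) [NeZero n] (i : ℤ) (j k : ℕ) :
    ∃ q : Seminorm ℂ (TestY n), Continuous q ∧ ∀ Φ : TestY n,
      ∫ p, ‖momentWeight i j Φ.toFun p * ((p.2.2⁻¹ ^ k : ℝ) : ℂ)‖ ∂(muY n) ≤ q Φ := by
  set idx : ℕ × ℕ × ℕ × ℕ × ℕ := (0, 0, 0, (i - k).natAbs + 2, j + 2) with hidx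
  set C : NNReal := Real.toNNReal (2 * ∫ p, dominant p ∂(muY n)) with hC
  have hC0 : 0 ≤ 2 * ∫ p, dominant p ∂(muY n) :=
    mul_nonneg zero_le_two (integral_nonneg fun p => by unfold dominant; positivity)
  refine ⟨C • rho n idx, ((rho_withSeminorms n).continuous_seminorm idx).const_smul C,
    fun Φ => ?_⟩
  have h : ∫ p, ‖momentWeight i j Φ.toFun p * ((p.2.2⁻¹ ^ k : ℝ) : ℂ)‖ ∂(muY n)
      ≤ ∫ p, (2 * rho n idx Φ) * dominant p ∂(muY n) := by
    refine integral_mono_ae (isRidgeWeight_momentWeight i j Φ k).norm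
      ((integrable_dominant n).const_mul _) ?_
    filter_upwards [ae_muY_pos n] with p hp
    rw [momentWeight_mul_inv_pow i j k _ hp]
    exact norm_momentWeight_le (i - k) j Φ hp
  rw [integral_const_mul] at h
  refine h.trans (le_of_eq ?_)
  have : (C • rho n idx) Φ = (C : ℝ) * rho n idx Φ := rfl
  rw [this, hC, Real.coe_toNNReal _ hC0]
  ring

/-! ### Multiplication of a ridgelet superposition by `|x|²` -/

/-- The superposition `x ↦ ∫ Φ(u, b, a) aⁱ bʲ χ((x · u - b) / a) du db da`. -/
def superposition {n : ℕ} [NeZero n] (i : ℤ) (j : ℕ) (χ : lizorkinReal) (Φ : TestY n) :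
    Euc n → ℂ := ridgeInt (momentWeight i j Φ.toFun) χ.1

theorem contDiffOn_radialExt_zeroExt {n : ℕ} [NeZero n] {Φ : Y n → ℂ} (hΦ : IsSmooth Φ)
    {c : ℝ × ℝ} (hc : 0 < c.2) : ContDiffOn ℝ ∞ (radialExt fun u => zeroExt Φ (u, c)) {0}ᶜ := by
  have h : ContDiffOn ℝ ∞ (fun x : Euc n => flat Φ (x, c)) {0}ᶜ :=
    hΦ.contDiffOn_flat.comp (contDiff_id.prodMk contDiff_const).contDiffOn fun x hx => ⟨hx, hc⟩
  exact h

theorem zeroExt_lapU {n : ℕ} {Φ : Y n → ℂ} (u : Sph n) {c : ℝ × ℝ} (hc : 0 < c.2) :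
    zeroExt (lapU Φ) (u, c) = sphLaplacian (fun u => zeroExt Φ (u, c)) u :=
  zeroExt_coe (lapU Φ) ⟨(u, c), hc⟩

/-- The operator `χ ↦ t² χ + (n - 1) t Iχ`, where `I` is the primitive. -/
def radialOp (n : ℕ) : lizorkinReal →L[ℂ] lizorkinReal :=
  mulL.comp (mulL + ((n : ℂ) - 1) • primitiveL)

/-- The operator `χ ↦ 2 t χ + (n - 1) Iχ`, where `I` is the primitive. -/
def crossOp (n : ℕ) : lizorkinReal →L[ℂ] lizorkinReal :=
  (2 : ℂ) • mulL + ((n : ℂ) - 1) • primitiveL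

theorem radialOp_apply (n : ℕ) (χ : lizorkinReal) (t : ℝ) :
    (radialOp n χ).1 t = t * (t * χ.1 t + ((n : ℂ) - 1) * (primitiveL χ).1 t) := by
  have e : (radialOp n χ) = mulL (mulL χ + ((n : ℂ) - 1) • primitiveL χ) := rfl
  rw [e, mulL_apply]
  have e2 : (mulL χ + ((n : ℂ) - 1) • primitiveL χ).1 t
      = (mulL χ).1 t + ((n : ℂ) - 1) * (primitiveL χ).1 t := rfl
  rw [e2, mulL_apply]

theorem crossOp_apply (n : ℕ) (χ : lizorkinReal) (t : ℝ) :
    (crossOp n χ).1 t = 2 * (t * χ.1 t) + ((n : ℂ) - 1) * (primitiveL χ).1 t := by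
  have e2 : (crossOp n χ).1 t
      = 2 * (mulL χ).1 t + ((n : ℂ) - 1) * (primitiveL χ).1 t := rfl
  rw [e2, mulL_apply]

/-- The factor `|x|²` is absorbed by applying the Laplace-Beltrami operator to `Φ`, at the expense
of primitives of `χ` and of powers of `a` and `b`. -/
theorem norm_sq_mul_superposition {n : ℕ} [NeZero n] (i : ℤ) (j : ℕ) (χ : lizorkinReal)
    (Φ : TestY n) (x : Euc n) :
    ((‖x‖ ^ 2 : ℝ) : ℂ) * superposition i j χ Φ x
      = superposition (i + 2) j (primitiveL (primitiveL χ)) (lapL n Φ) x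
        + superposition (i + 2) j (radialOp n χ) Φ x
        + superposition (i + 1) (j + 1) (crossOp n χ) Φ x
        + superposition i (j + 2) χ Φ x := by
  have hI := fun (i : ℤ) (j : ℕ) (χ : lizorkinReal) (Φ : TestY n) =>
    (isRidgeWeight_momentWeight i j Φ).integrable_mul χ.1 x
  have hI1 := hI (i + 2) j (primitiveL (primitiveL χ)) (lapL n Φ)
  have hI2 := hI (i + 2) j (radialOp n χ) Φ
  have hI3 := hI (i + 1) (j + 1) (crossOp n χ) Φ
  have hI4 := hI i (j + 2) χ Φ
  have hI0 := hI i j χ Φ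
  have hS := ((hI1.add hI2).add hI3).add hI4
  have hsum := integral_add' ((hI1.add hI2).add hI3) hI4
  rw [integral_add' (hI1.add hI2) hI3, integral_add' hI1 hI2] at hsum
  refine Eq.trans ?_ hsum
  simp only [superposition, ridgeInt]
  rw [muY] at hS hI0 ⊢
  rw [integral_prod_symm _ hI0, ← integral_const_mul]
  refine Eq.trans ?_ (integral_prod_symm _ hS).symm
  have hpos : ∀ᵐ c ∂((volume : Measure ℝ).prod ((volume : Measure ℝ).restrict (Ioi 0))),
      0 < c.2 :=
    (Measure.quasiMeasurePreserving_snd (μ := (volume : Measure ℝ))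
      (ν := (volume : Measure ℝ).restrict (Ioi 0))).ae (ae_restrict_mem measurableSet_Ioi)
  refine integral_congr_ae ?_
  filter_upwards [hpos] with c hc
  obtain ⟨b, a⟩ := c
  have ha : 0 < a := hc
  have ha' : (a : ℂ) ≠ 0 := by exact_mod_cast ha.ne'
  -- As a function of `t = x · u`, `χ((t - b) / a)` is the second derivative of `w`.
  have hw : ∀ (ξ : lizorkinReal) (t : ℝ), HasDerivAt (fun t => (primitiveL ξ).1 ((t - b) / a))
      ((a : ℂ)⁻¹ * ξ.1 ((t - b) / a)) t := fun ξ t => by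
    have h1 : HasDerivAt (fun t : ℝ => (t - b) / a) a⁻¹ t := by
      simpa using ((hasDerivAt_id t).sub_const b).div_const a
    have h2 := (hasDerivAt_primitiveL ξ ((t - b) / a)).scomp t h1
    simpa [Function.comp_def, Complex.real_smul] using h2
  have hkey := norm_sq_mul_integral_ridge (F := fun u => zeroExt Φ.toFun (u, b, a))
    (w := fun t => (a : ℂ) ^ 2 * (primitiveL (primitiveL χ)).1 ((t - b) / a))
    (w' := fun t => (a : ℂ) * (primitiveL χ).1 ((t - b) / a))
    (w'' := fun t => χ.1 ((t - b) / a))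
    (contDiffOn_radialExt_zeroExt Φ.isSmooth hc)
    (contDiff_const.mul (((primitiveL (primitiveL χ)).1.smooth ⊤).comp
      ((contDiff_id.sub contDiff_const).div_const a)))
    (fun t => by
      refine ((hw (primitiveL χ) t).const_mul _).congr_deriv ?_
      field_simp)
    (fun t => by
      refine ((hw χ t).const_mul _).congr_deriv ?_
      field_simp) x
  have hcongr := congrArg (fun z => ((a ^ i * b ^ j : ℝ) : ℂ) * z) hkey
  simp only [← integral_const_mul] at hcongr
  rw [← integral_const_mul]
  refine Eq.trans ?_ (hcongr.trans ?_)
  · refine integral_congr_ae (Filter.Eventually.of_forall fun u => ?_)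
    simp only [momentWeight, ridgeArg]
    ring
  · refine integral_congr_ae (Filter.Eventually.of_forall fun u => ?_)
    have hz : zeroExt (lapL n Φ).toFun (u, b, a)
        = sphLaplacian (fun u => zeroExt Φ.toFun (u, b, a)) u := zeroExt_lapU u hc
    simp only [momentWeight, ridgeArg, Pi.add_apply, hz, radialOp_apply, crossOp_apply]
    rw [zpow_add₀ ha.ne', zpow_add₀ ha.ne', zpow_one, zpow_ofNat]
    push_cast
    set t : ℂ := ((⟪x, (u : Euc n)⟫_ℝ : ℝ) : ℂ) with ht
    field_simp
    ring

/-! ### Rapid decay -/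

/-- All the derivatives of the functions `G χ Φ` are bounded, uniformly on `ℝⁿ`, by products of
continuous seminorms of `χ` and of `Φ`. -/
def IsControlled {n : ℕ} [NeZero n] (G : lizorkinReal → TestY n → Euc n → ℂ) : Prop :=
  (∀ χ Φ, ContDiff ℝ ∞ (G χ Φ)) ∧ ∀ m : ℕ, ∃ (p : Seminorm ℂ lizorkinReal)
    (q : Seminorm ℂ (TestY n)), Continuous p ∧ Continuous q ∧
      ∀ χ Φ x, ‖iteratedFDeriv ℝ m (G χ Φ) x‖ ≤ p χ * q Φ

theorem IsControlled.add {n : ℕ} [NeZero n] {G H : lizorkinReal → TestY n → Euc n → ℂ}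
    (hG : IsControlled G) (hH : IsControlled H) : IsControlled fun χ Φ => G χ Φ + H χ Φ := by
  refine ⟨fun χ Φ => (hG.1 χ Φ).add (hH.1 χ Φ), fun m => ?_⟩
  obtain ⟨p, q, hp, hq, h⟩ := hG.2 m
  obtain ⟨p', q', hp', hq', h'⟩ := hH.2 m
  refine ⟨p + p', q + q', hp.add hp', hq.add hq', fun χ Φ x => ?_⟩
  have hm : (m : ℕ∞ω) ≤ ∞ := by exact_mod_cast le_top
  rw [iteratedFDeriv_add ((hG.1 χ Φ).of_le hm) ((hH.1 χ Φ).of_le hm), Pi.add_apply]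
  refine (norm_add_le _ _).trans ((add_le_add (h χ Φ x) (h' χ Φ x)).trans ?_)
  rw [add_apply, add_apply]
  have h1 : 0 ≤ p χ := apply_nonneg _ _
  have h2 : 0 ≤ p' χ := apply_nonneg _ _
  have h3 : 0 ≤ q Φ := apply_nonneg _ _
  have h4 : 0 ≤ q' Φ := apply_nonneg _ _
  nlinarith [mul_nonneg h1 h4, mul_nonneg h2 h3]

theorem IsControlled.comp {n : ℕ} [NeZero n] {G : lizorkinReal → TestY n → Euc n → ℂ}
    (hG : IsControlled G) (A : lizorkinReal →L[ℂ] lizorkinReal) (B : TestY n →L[ℂ] TestY n) :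
    IsControlled fun χ Φ => G (A χ) (B Φ) := by
  refine ⟨fun χ Φ => hG.1 _ _, fun m => ?_⟩
  obtain ⟨p, q, hp, hq, h⟩ := hG.2 m
  exact ⟨p.comp A.toLinearMap, q.comp B.toLinearMap, hp.comp A.continuous, hq.comp B.continuous,
    fun χ Φ x => h (A χ) (B Φ) x⟩

theorem isControlled_superposition {n : ℕ} [NeZero n] (i : ℤ) (j : ℕ) :
    IsControlled fun χ (Φ : TestY n) => superposition i j χ Φ := by
  refine ⟨fun χ Φ => contDiff_ridgeInt (isRidgeWeight_momentWeight i j Φ) χ.1, fun m => ?_⟩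
  obtain ⟨q, hq, h⟩ := exists_seminorm_integral_momentWeight_le n i j m
  refine ⟨(SchwartzMap.seminorm ℂ 0 m).comp lizorkinReal.subtype, q,
    continuous_seminorm_lizorkinReal 0 m, hq, fun χ Φ x => ?_⟩
  refine (norm_iteratedFDeriv_ridgeInt_le (isRidgeWeight_momentWeight i j Φ) χ.1 m x).trans ?_
  rw [mul_comm]
  exact mul_le_mul_of_nonneg_left (h Φ) (apply_nonneg _ _)

/-- Induction on `N`: a factor `1 + |x|²` is expanded by `norm_sq_mul_superposition` into
superpositions with other `i`, `j`, `χ`, `Φ`, each multiplied by one power less. -/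
theorem isControlled_pow_smul_superposition {n : ℕ} [NeZero n] (N : ℕ) (i : ℤ) (j : ℕ) :
    IsControlled fun χ (Φ : TestY n) x => (1 + ‖x‖ ^ 2) ^ N • superposition i j χ Φ x := by
  induction N generalizing i j with
  | zero => simpa using isControlled_superposition i j
  | succ N ih =>
    have h := ((((ih i j).add ((ih (i + 2) j).comp (primitiveL.comp primitiveL) (lapL n))).add
      ((ih (i + 2) j).comp (radialOp n) (ContinuousLinearMap.id ℂ _))).add
      ((ih (i + 1) (j + 1)).comp (crossOp n) (ContinuousLinearMap.id ℂ _))).add (ih i (j + 2))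
    convert h using 3 with χ Φ
    funext x
    have hx := norm_sq_mul_superposition i j χ Φ x
    simp only [Pi.add_apply, ← smul_add, ContinuousLinearMap.comp_apply,
      ContinuousLinearMap.id_apply]
    rw [pow_succ, mul_smul]
    congr 1
    rw [add_smul, one_smul, Complex.real_smul, hx]
    ring

theorem exists_seminorm_pow_mul_iteratedFDeriv_superposition_le (n : ℕ) [NeZero n] (i : ℤ)
    (j k m : ℕ) : ∃ (p : Seminorm ℂ lizorkinReal) (q : Seminorm ℂ (TestY n)),
      Continuous p ∧ Continuous q ∧ ∀ χ Φ x,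
        ‖x‖ ^ k * ‖iteratedFDeriv ℝ m (superposition i j χ Φ) x‖ ≤ p χ * q Φ := by
  obtain ⟨N, C, hC0, hC⟩ := exists_norm_pow_mul_iteratedFDeriv_le (Euc n) k m
  choose p q hp hq h using (isControlled_pow_smul_superposition (n := n) N i j).2
  have hsum : ∀ M : ℕ, ∃ (P : Seminorm ℂ lizorkinReal) (Q : Seminorm ℂ (TestY n)),
      Continuous P ∧ Continuous Q ∧
        ∀ χ Φ, ∑ l ∈ Finset.range M, p l χ * q l Φ ≤ P χ * Q Φ := by
    intro M
    induction M with
    | zero => exact ⟨0, 0, continuous_const, continuous_const, fun χ Φ => by simp⟩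
    | succ M ih =>
      obtain ⟨P, Q, hP, hQ, hPQ⟩ := ih
      refine ⟨P + p M, Q + q M, hP.add (hp M), hQ.add (hq M), fun χ Φ => ?_⟩
      rw [Finset.sum_range_succ, add_apply, add_apply]
      have h1 : 0 ≤ P χ := apply_nonneg _ _
      have h2 : 0 ≤ p M χ := apply_nonneg _ _
      have h3 : 0 ≤ Q Φ := apply_nonneg _ _
      have h4 : 0 ≤ q M Φ := apply_nonneg _ _
      nlinarith [hPQ χ Φ, mul_nonneg h1 h4, mul_nonneg h2 h3]
  obtain ⟨P, Q, hP, hQ, hPQ⟩ := hsum (m + 1)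
  refine ⟨C.toNNReal • P, Q, hP.const_smul C.toNNReal, hQ, fun χ Φ x => ?_⟩
  have hb := hC (superposition i j χ Φ) (fun l => p l χ * q l Φ)
    ((isControlled_superposition i j).1 χ Φ) (fun l _ x => h l χ Φ x) x
  have e : (C.toNNReal • P) χ = (C.toNNReal : ℝ) * P χ := rfl
  rw [e, Real.coe_toNNReal _ hC0, mul_assoc]
  exact hb.trans (mul_le_mul_of_nonneg_left (hPQ χ Φ) hC0)

/-- The superposition of ridgelets as a Schwartz function. -/
def superpositionS {n : ℕ} [NeZero n] (i : ℤ) (j : ℕ) (χ : lizorkinReal) (Φ : TestY n) :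
    𝓢(Euc n, ℂ) where
  toFun := superposition i j χ Φ
  smooth' := (isControlled_superposition i j).1 χ Φ
  decay' := fun k m => by
    obtain ⟨p, q, -, -, h⟩ := exists_seminorm_pow_mul_iteratedFDeriv_superposition_le n i j k m
    exact ⟨_, h χ Φ⟩

/-! ### Vanishing moments -/

theorem hasLineDerivAt_monomial {n : ℕ} (m : Fin n → ℕ) (l : Fin n) (x : Euc n) :
    HasLineDerivAt ℝ (fun x : Euc n => (monomial m x : ℂ))
      ((m l : ℂ) * (monomial (Function.update m l (m l - 1)) x : ℂ)) x
      (EuclideanSpace.basisFun (Fin n) ℝ l) := by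
  have hprod : ∀ (k : ℕ) (t : ℝ), (monomial (Function.update m l k)
      (x + t • EuclideanSpace.basisFun (Fin n) ℝ l))
      = (x l + t) ^ k * ∏ i ∈ Finset.univ.erase l, x i ^ m i := by
    intro k t
    rw [monomial, ← Finset.mul_prod_erase _ _ (Finset.mem_univ l)]
    congr 1
    · simp
    · refine Finset.prod_congr rfl fun i hi => ?_
      have hil : i ≠ l := Finset.ne_of_mem_erase hi
      simp [hil]
  have h1 : HasDerivAt (fun t : ℝ => (x l + t) ^ m l * ∏ i ∈ Finset.univ.erase l, x i ^ m i)
      ((m l : ℝ) * (x l) ^ (m l - 1) * ∏ i ∈ Finset.univ.erase l, x i ^ m i) 0 := by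
    have := (((hasDerivAt_id (0 : ℝ)).const_add (x l)).pow (m l)).mul_const
      (∏ i ∈ Finset.univ.erase l, x i ^ m i)
    simpa using this
  have h2 := h1.ofReal_comp
  have e0 := hprod (m l - 1) 0
  rw [zero_smul, add_zero, add_zero] at e0
  rw [HasLineDerivAt, e0]
  have e1 : (fun t : ℝ => (monomial m (x + t • EuclideanSpace.basisFun (Fin n) ℝ l) : ℂ))
      = fun t : ℝ => (((x l + t) ^ m l * ∏ i ∈ Finset.univ.erase l, x i ^ m i : ℝ) : ℂ) := by
    funext t
    rw [← hprod (m l) t, Function.update_eq_self]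
  rw [e1]
  refine h2.congr_deriv ?_
  push_cast
  ring

open scoped LineDeriv in
theorem integral_monomial_mul_lineDeriv {n : ℕ} (m : Fin n → ℕ) (l : Fin n) (h : 𝓢(Euc n, ℂ)) :
    ∫ x, (monomial m x : ℂ) * (∂_{EuclideanSpace.basisFun (Fin n) ℝ l} h) x
      = -((m l : ℂ) * ∫ x, (monomial (Function.update m l (m l - 1)) x : ℂ) * h x) := by
  generalize he : EuclideanSpace.basisFun (Fin n) ℝ l = e
  set h' : 𝓢(Euc n, ℂ) := ∂_{e} h with hh'
  have h1 : Integrable (fun x => ContinuousLinearMap.mul ℝ ℂ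
      ((m l : ℂ) * (monomial (Function.update m l (m l - 1)) x : ℂ)) (h x)) := by
    simp only [ContinuousLinearMap.mul_apply', mul_assoc]
    exact (integrable_monomial_mul h _).const_mul _
  have h2 : Integrable (fun x => ContinuousLinearMap.mul ℝ ℂ (monomial m x : ℂ) (h' x)) :=
    integrable_monomial_mul h' m
  have h3 : Integrable (fun x => ContinuousLinearMap.mul ℝ ℂ (monomial m x : ℂ) (h x)) :=
    integrable_monomial_mul h m
  have hI := integral_bilinear_hasLineDerivAt_right_eq_neg_left_of_integrable (v := e) h1 h2 h3
    (fun x _ => he ▸ hasLineDerivAt_monomial m l x)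
    (fun x _ => by
      rw [hh', SchwartzMap.lineDerivOp_apply_eq_fderiv]
      exact (h.hasFDerivAt x).hasLineDerivAt e)
  simp only [ContinuousLinearMap.mul_apply', mul_assoc] at hI
  rw [hI, integral_const_mul]

open scoped LineDeriv in
/-- A superposition of ridgelets is the Laplacian of another one, since `u` is a unit vector. -/
theorem superposition_eq_sum_lineDeriv {n : ℕ} [NeZero n] (i : ℤ) (j : ℕ) (χ : lizorkinReal)
    (Φ : TestY n) (x : Euc n) : superposition i j χ Φ x = ∑ l : Fin n,
      (∂_{EuclideanSpace.basisFun (Fin n) ℝ l} (∂_{EuclideanSpace.basisFun (Fin n) ℝ l}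
        (superpositionS (i + 2) j (primitiveL (primitiveL χ)) Φ))) x := by
  have hW := isRidgeWeight_momentWeight (i + 2) j Φ
  set χ₂ := (primitiveL (primitiveL χ)).1 with hχ₂
  have hd : SchwartzMap.derivCLM ℂ ℂ (SchwartzMap.derivCLM ℂ ℂ χ₂) = χ.1 := by
    have h1 : ∀ ξ : lizorkinReal, SchwartzMap.derivCLM ℂ ℂ (primitiveL ξ).1 = ξ.1 := fun ξ => by
      ext t
      rw [SchwartzMap.derivCLM_apply]
      exact (hasDerivAt_primitiveL ξ t).deriv
    rw [hχ₂, h1, h1]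
  have hterm : ∀ v : Euc n, (∂_{v} (∂_{v} (superpositionS (i + 2) j
      (primitiveL (primitiveL χ)) Φ))) x
      = ridgeInt (derivWeight v (derivWeight v (momentWeight (i + 2) j Φ.toFun))) χ.1 x := by
    intro v
    have e1 : ⇑(∂_{v} (superpositionS (i + 2) j (primitiveL (primitiveL χ)) Φ) : 𝓢(Euc n, ℂ))
        = ridgeInt (derivWeight v (momentWeight (i + 2) j Φ.toFun))
          (SchwartzMap.derivCLM ℂ ℂ χ₂) := by
      rw [← fderiv_ridgeInt hW χ₂ v]
      funext y
      rw [SchwartzMap.lineDerivOp_apply_eq_fderiv]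
      rfl
    rw [SchwartzMap.lineDerivOp_apply_eq_fderiv, e1, ← hd,
      ← fderiv_ridgeInt (hW.derivWeight v) (SchwartzMap.derivCLM ℂ ℂ χ₂) v]
  simp only [hterm, ridgeInt]
  rw [← integral_finsetSum _ fun l _ =>
    ((hW.derivWeight _).derivWeight _).integrable_mul χ.1 x]
  refine integral_congr_ae ?_
  filter_upwards [ae_muY_pos n] with p hp
  have hp' : (p.2.2 : ℂ) ≠ 0 := by exact_mod_cast hp.ne'
  have hu : ‖(p.1 : Euc n)‖ = 1 := norm_eq_of_mem_sphere p.1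
  have hsum : ∑ l, ((⟪(p.1 : Euc n), EuclideanSpace.basisFun (Fin n) ℝ l⟫_ℝ : ℝ) : ℂ) ^ 2 = 1 := by
    have : ∑ l, ⟪(p.1 : Euc n), EuclideanSpace.basisFun (Fin n) ℝ l⟫_ℝ ^ 2 = ‖(p.1 : Euc n)‖ ^ 2 := by
      rw [← real_inner_self_eq_norm_sq,
        ← (EuclideanSpace.basisFun (Fin n) ℝ).sum_inner_mul_inner (p.1 : Euc n) p.1]
      exact Finset.sum_congr rfl fun i _ => by
        rw [real_inner_comm (p.1 : Euc n) (EuclideanSpace.basisFun (Fin n) ℝ i), sq]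
    rw [hu, one_pow] at this
    exact_mod_cast this
  have hl : ∀ l : Fin n, derivWeight (EuclideanSpace.basisFun (Fin n) ℝ l)
      (derivWeight (EuclideanSpace.basisFun (Fin n) ℝ l) (momentWeight (i + 2) j Φ.toFun)) p
        * χ.1 (ridgeArg x p)
      = (momentWeight i j Φ.toFun p * χ.1 (ridgeArg x p)) *
        ((⟪(p.1 : Euc n), EuclideanSpace.basisFun (Fin n) ℝ l⟫_ℝ : ℝ) : ℂ) ^ 2 := by
    intro l
    rw [derivWeight, derivWeight, momentWeight, momentWeight, zpow_add₀ hp.ne', zpow_ofNat]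
    push_cast
    field_simp
  rw [Finset.sum_congr rfl fun l _ => hl l, ← Finset.mul_sum, hsum, mul_one]

/-- Each integration by parts against the Laplacian lowers the degree of the monomial by two. -/
theorem integral_monomial_mul_superposition {n : ℕ} [NeZero n] (m : Fin n → ℕ) (i : ℤ) (j : ℕ)
    (χ : lizorkinReal) (Φ : TestY n) :
    ∫ x, (monomial m x : ℂ) * superposition i j χ Φ x = 0 := by
  induction hd : ∑ l, m l using Nat.strong_induction_on generalizing m i χ with
  | _ d ih =>
    simp only [superposition_eq_sum_lineDeriv i j χ Φ, Finset.mul_sum]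
    rw [integral_finsetSum _ fun l _ => integrable_monomial_mul _ m]
    refine Finset.sum_eq_zero fun l _ => ?_
    rw [integral_monomial_mul_lineDeriv, integral_monomial_mul_lineDeriv]
    rcases Nat.lt_or_ge (m l) 2 with h | h
    · have : (m l : ℂ) = 0 ∨ m l - 1 = 0 := by
        rcases Nat.lt_or_ge (m l) 1 with h1 | h1
        · left; exact_mod_cast Nat.lt_one_iff.1 h1
        · right; omega
      rcases this with h0 | h0 <;> simp [h0]
    · have hlt : ∑ k, Function.update (Function.update m l (m l - 1)) l
          (Function.update m l (m l - 1) l - 1) k < d := by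
        rw [← hd]
        refine Finset.sum_lt_sum (fun k _ => ?_) ⟨l, Finset.mem_univ l, ?_⟩
        · by_cases hk : k = l
          · subst hk; simp; omega
          · simp [hk]
        · simp; omega
      have h0 := ih _ hlt _ (i + 2) (primitiveL (primitiveL χ)) rfl
      have h0' : ∫ x, (monomial (Function.update (Function.update m l (m l - 1)) l
          (Function.update m l (m l - 1) l - 1)) x : ℂ) *
          superpositionS (i + 2) j (primitiveL (primitiveL χ)) Φ x = 0 := h0
      rw [h0']
      simp

/-! ### The synthesis operator -/

theorem ridgeInt_add_left {n : ℕ} {W W' : Sph n × ℝ × ℝ → ℂ} (hW : IsRidgeWeight W)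
    (hW' : IsRidgeWeight W') (χ : 𝓢(ℝ, ℂ)) (x : Euc n) :
    ridgeInt (W + W') χ x = ridgeInt W χ x + ridgeInt W' χ x := by
  simp only [ridgeInt]
  rw [← integral_add (hW.integrable_mul χ x) (hW'.integrable_mul χ x)]
  exact integral_congr_ae (Filter.Eventually.of_forall fun p => add_mul _ _ _)

theorem ridgeInt_add_right {n : ℕ} {W : Sph n × ℝ × ℝ → ℂ} (hW : IsRidgeWeight W)
    (χ χ' : 𝓢(ℝ, ℂ)) (x : Euc n) :
    ridgeInt W (χ + χ' : 𝓢(ℝ, ℂ)) x = ridgeInt W χ x + ridgeInt W χ' x := by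
  simp only [ridgeInt]
  rw [← integral_add (hW.integrable_mul χ x) (hW.integrable_mul χ' x)]
  exact integral_congr_ae (Filter.Eventually.of_forall fun p => mul_add _ _ _)

theorem ridgeInt_smul_left {n : ℕ} (c : ℂ) (W : Sph n × ℝ × ℝ → ℂ) (χ : ℝ → ℂ) (x : Euc n) :
    ridgeInt (c • W) χ x = c * ridgeInt W χ x := by
  simp only [ridgeInt]
  rw [← integral_const_mul]
  exact integral_congr_ae (Filter.Eventually.of_forall fun p => mul_assoc _ _ _)

theorem ridgeInt_smul_right {n : ℕ} (c : ℂ) (W : Sph n × ℝ × ℝ → ℂ) (χ : 𝓢(ℝ, ℂ)) (x : Euc n) :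
    ridgeInt W (c • χ : 𝓢(ℝ, ℂ)) x = c * ridgeInt W χ x := by
  simp only [ridgeInt]
  rw [← integral_const_mul]
  exact integral_congr_ae (Filter.Eventually.of_forall fun p => mul_left_comm _ _ _)

theorem zeroExt_add {n : ℕ} (Φ Ψ : Y n → ℂ) : zeroExt (Φ + Ψ) = zeroExt Φ + zeroExt Ψ := by
  funext p
  simp only [zeroExt, Pi.add_apply]
  split_ifs <;> simp

theorem zeroExt_smul {n : ℕ} (c : ℂ) (Φ : Y n → ℂ) : zeroExt (c • Φ) = c • zeroExt Φ := by
  funext p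
  simp only [zeroExt, Pi.smul_apply]
  split_ifs <;> simp

theorem momentWeight_add {n : ℕ} (i : ℤ) (j : ℕ) (Φ Ψ : Y n → ℂ) :
    momentWeight i j (Φ + Ψ) = momentWeight i j Φ + momentWeight i j Ψ := by
  funext p
  simp only [momentWeight, zeroExt_add, Pi.add_apply, add_mul]

theorem momentWeight_smul {n : ℕ} (c : ℂ) (i : ℤ) (j : ℕ) (Φ : Y n → ℂ) :
    momentWeight i j (c • Φ) = c • momentWeight i j Φ := by
  funext p
  simp only [momentWeight, zeroExt_smul, Pi.smul_apply, smul_eq_mul, mul_assoc]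

/-- The superpositions of ridgelets as a bilinear map into `𝓢₀(ℝⁿ)`. -/
def superpositionB (n : ℕ) [NeZero n] (i : ℤ) (j : ℕ) :
    TestY n →ₗ[ℂ] lizorkinReal →ₗ[ℂ] lizorkin n :=
  LinearMap.mk₂ ℂ
    (fun Φ χ => ⟨superpositionS i j χ Φ, fun m => integral_monomial_mul_superposition m i j χ Φ⟩)
    (fun Φ Ψ χ => by
      ext x
      have h := ridgeInt_add_left (isRidgeWeight_momentWeight i j Φ)
        (isRidgeWeight_momentWeight i j Ψ) χ.1 x
      rw [← momentWeight_add] at h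
      exact h)
    (fun c Φ χ => by
      ext x
      have h := ridgeInt_smul_left c (momentWeight i j Φ.toFun) χ.1 x
      rw [← momentWeight_smul] at h
      exact h)
    (fun Φ χ χ' => by
      ext x
      exact ridgeInt_add_right (isRidgeWeight_momentWeight i j Φ) χ.1 χ'.1 x)
    (fun c Φ χ => by
      ext x
      exact ridgeInt_smul_right c (momentWeight i j Φ.toFun) χ.1 x)

/-- A bilinear map is jointly continuous if each seminorm of its values is bounded by a product
of continuous seminorms. -/
theorem continuous_bilinear_of_seminorm {E F G ι : Type*} [AddCommGroup E] [Module ℂ E]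
    [TopologicalSpace E] [IsTopologicalAddGroup E] [AddCommGroup F] [Module ℂ F]
    [TopologicalSpace F] [IsTopologicalAddGroup F] [AddCommGroup G] [Module ℂ G]
    [TopologicalSpace G] {r : SeminormFamily ℂ G ι} (hr : WithSeminorms r)
    (B : E →ₗ[ℂ] F →ₗ[ℂ] G)
    (hB : ∀ i, ∃ (p : Seminorm ℂ E) (q : Seminorm ℂ F), Continuous p ∧ Continuous q ∧
      ∀ x y, r i (B x y) ≤ p x * q y) : Continuous fun z : E × F => B z.1 z.2 := by
  refine continuous_iff_continuousAt.2 fun z₀ => (hr.tendsto_nhds _ _).2 fun i ε hε => ?_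
  obtain ⟨p, q, hp, hq, h⟩ := hB i
  have hlim : Filter.Tendsto
      (fun z : E × F => p (z.1 - z₀.1) * q z.2 + p z₀.1 * q (z.2 - z₀.2)) (nhds z₀) (nhds 0) := by
    have hc : Continuous
        fun z : E × F => p (z.1 - z₀.1) * q z.2 + p z₀.1 * q (z.2 - z₀.2) :=
      ((hp.comp (continuous_fst.sub continuous_const)).mul (hq.comp continuous_snd)).add
        (continuous_const.mul (hq.comp (continuous_snd.sub continuous_const)))
    have := hc.tendsto z₀
    simpa using this
  filter_upwards [hlim.eventually_lt_const hε] with z hz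
  refine lt_of_le_of_lt ?_ hz
  have e : B z.1 z.2 - B z₀.1 z₀.2 = B (z.1 - z₀.1) z.2 + B z₀.1 (z.2 - z₀.2) := by
    rw [map_sub, map_sub, LinearMap.sub_apply]
    abel
  rw [e]
  exact (map_add_le_add _ _ _).trans (add_le_add (h _ _) (h _ _))

theorem withSeminorms_lizorkin (n : ℕ) : WithSeminorms
    ((schwartzSeminormFamily ℂ (Euc n) ℂ).comp (lizorkin n).subtype) :=
  LinearMap.withSeminorms_induced (schwartz_withSeminorms ℂ (Euc n) ℂ) (lizorkin n).subtype

theorem continuous_superpositionB (n : ℕ) [NeZero n] (i : ℤ) (j : ℕ) :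
    Continuous fun z : TestY n × lizorkinReal => superpositionB n i j z.1 z.2 := by
  refine continuous_bilinear_of_seminorm (withSeminorms_lizorkin n) _ fun km => ?_
  obtain ⟨k, m⟩ := km
  obtain ⟨p, q, hp, hq, h⟩ :=
    exists_seminorm_pow_mul_iteratedFDeriv_superposition_le n i j k m
  refine ⟨q, p, hq, hp, fun Φ χ => ?_⟩
  rw [mul_comm]
  exact SchwartzMap.seminorm_le_bound ℂ k m _
    (mul_nonneg (apply_nonneg _ _) (apply_nonneg _ _)) fun x => h χ Φ x

/-- The exponent `-(n + 1)` collects the factor `a⁻¹` of the ridgelet and the density `a⁻ⁿ`. -/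
theorem synthesisIntegrand_eq {n : ℕ} (Φ : Y n → ℂ) (ψ : ℝ → ℂ) (x : Euc n)
    {p : Sph n × ℝ × ℝ} (hp : 0 < p.2.2) : synthesisIntegrand Φ ψ x p
      = momentWeight (-((n : ℤ) + 1)) 0 Φ p * ψ (ridgeArg x p) := by
  have hp' : (p.2.2 : ℂ) ≠ 0 := by exact_mod_cast hp.ne'
  have e : p.2.2 ^ (-((n : ℤ) + 1)) = (1 / p.2.2) * (1 / p.2.2 ^ n) := by
    rw [zpow_neg, zpow_add_one₀ hp.ne', zpow_natCast]
    field_simp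
  rw [synthesisIntegrand, ridgelet, momentWeight, e, ridgeArg]
  push_cast
  ring

theorem synthesisConverges {n : ℕ} [NeZero n] (Φ : TestY n) (ψ : lizorkinReal) (x : Euc n) :
    SynthesisConverges Φ.toFun ψ.1 x := by
  refine ((isRidgeWeight_momentWeight (-((n : ℤ) + 1)) 0 Φ).integrable_mul ψ.1 x).congr ?_
  filter_upwards [ae_muY_pos n] with p hp using (synthesisIntegrand_eq _ _ x hp).symm

theorem superposition_eq_synthesis {n : ℕ} [NeZero n] (Φ : TestY n) (ψ : lizorkinReal)
    (x : Euc n) : superposition (-((n : ℤ) + 1)) 0 ψ Φ x = synthesis Φ.toFun ψ.1 x := by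
  have hint := synthesisConverges Φ ψ x
  have h1 : superposition (-((n : ℤ) + 1)) 0 ψ Φ x
      = ∫ p, synthesisIntegrand Φ.toFun ψ.1 x p ∂(muY n) := by
    refine integral_congr_ae ?_
    filter_upwards [ae_muY_pos n] with p hp using (synthesisIntegrand_eq _ _ x hp).symm
  rw [h1, muY, integral_prod _ hint, synthesis]
  refine integral_congr_ae ?_
  filter_upwards [hint.prod_right_ae] with u hu
  exact integral_prod_symm _ hu

end

end Ridgelet

theorem theorem4p2 (n : ℕ) [NeZero n] (hn : 2 ≤ n) :
    (∀ (Φ : Ridgelet.TestY n) (ψ : Ridgelet.lizorkinReal) (x : Ridgelet.Euc n),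
      Ridgelet.SynthesisConverges Φ.toFun ψ.1 x) ∧
    ∃ B : Ridgelet.TestY n →ₗ[ℂ] Ridgelet.lizorkinReal →ₗ[ℂ] Ridgelet.lizorkin n,
      (∀ (Φ : Ridgelet.TestY n) (ψ : Ridgelet.lizorkinReal) (x : Ridgelet.Euc n),
        (B Φ ψ).1 x = Ridgelet.synthesis Φ.toFun ψ.1 x) ∧
      Continuous fun p : Ridgelet.TestY n × Ridgelet.lizorkinReal => B p.1 p.2 :=
  ⟨Ridgelet.synthesisConverges, Ridgelet.superpositionB n (-((n : ℤ) + 1)) 0,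
    Ridgelet.superposition_eq_synthesis, Ridgelet.continuous_superpositionB n _ 0⟩
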